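/- Let $\kappa\ge 1$, $A\in\mathbb{R}^{m\times m}$, $B\in\mathbb{R}^{m\times r}$ and let $\Sigma_1,\Sigma_w\in\mathbb{R}^{m\times m}$ be positive semi-definite. Consider, for $k=1,\dots,\kappa$, the system $$x_{k+1}=Ax_k+Bu_k+w_k,\qquad s_k=\sum_{j=1}^{k}L_{k,j}'x_j+\vartheta_k,\qquad u_k=\gamma_k(s_1,\dots,s_k),$$ where $x_1\sim\mathcal N(0,\Sigma_1)$, $w_k\sim\mathcal N(0,\Sigma_w)$ and $\vartheta_k\sim\mathcal N(0,\Theta_k)$ are mutually independent and the $\gamma_k$ are Borel measurable. A linear-plus-noise signaling rule $\eta$ is an arbitrary choice of gains $L_{k,j}\in\mathbb{R}^{m\times m}$ $(1\le j\le k\le\kappa)$ and of positive semi-definite $\Theta_k\in\mathbb{R}^{m\times m}$; it is memoryless if $L_{k,j}=0$ for $j<k$. The control-free state is $x_1^o=x_1$, $x_{k+1}^o=Ax_k^o+w_k$, with second moment $\Sigma_k^o=\mathbb{E}[x_k^o(x_k^o)']$, so that $\Sigma_1^o=\Sigma_1$ and $\Sigma_{k+1}^o=A\Sigma_k^oA'+\Sigma_w$.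 Put $H_k=\mathrm{cov}\big(\mathbb{E}[x_k^o\mid s_1,\dots,s_k]\big)$, and write $M\succeq N$ if $M-N$ is positive semi-definite. (Necessity.) For every linear-plus-noise signaling rule and every control policy $\gamma$, $$\Sigma_1^o\succeq H_1\succeq O,\qquad \Sigma_k^o\succeq H_k\succeq AH_{k-1}A'\quad(1<k\le\kappa).$$ (Sufficiency.) Let $S_1,\dots,S_\kappa$ be positive semi-definite matrices with $\Sigma_1^o\succeq S_1\succeq O$ and $\Sigma_k^o\succeq S_k\succeq AS_{k-1}A'$ for $1<k\le\kappa$. Then there is a memoryless linear-plus-noise signaling rule with $H_k=S_k$ for all $k$, whatever the control policy is. Explicitly, with the convention $AS_0A'=O$: for each $k$ let $$\Sigma_k^o-AS_{k-1}A'=\bar U_k\begin{bmatrix}\bar\Lambda_k&O\\O&O\end{bmatrix}\bar U_k'$$ be an eigen-decomposition with $\bar U_k$ orthogonal and $\bar\Lambda_k$ diagonal and positive definite of size $t_k=\mathrm{rank}(\Sigma_k^o-AS_{k-1}A')$, let $$T_k=\begin{bmatrix}\bar\Lambda_k^{-1/2}&O\end{bmatrix}\bar U_k'(S_k-AS_{k-1}A')\bar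 U_k\begin{bmatrix}\bar\Lambda_k^{-1/2}\\O\end{bmatrix},$$ and let $T_k=U_k\Lambda_kU_k'$ be an eigen-decomposition, with $U_k$ orthogonal and $\Lambda_k=\mathrm{diag}(\lambda_{k,1},\dots,\lambda_{k,t_k})$. Such decompositions exist, and for every choice of them $\lambda_{k,i}\in[0,1]$ for all $i$. Hence there are real numbers $\lambda^o_{k,i},\theta_{k,i}$ with $$(\lambda^o_{k,i})^2+\theta_{k,i}^2>0,\qquad\frac{(\lambda^o_{k,i})^2}{(\lambda^o_{k,i})^2+\theta_{k,i}^2}=\lambda_{k,i}\qquad(1\le i\le t_k),$$ and for every choice of these decompositions and numbers, the memoryless rule $s_k=L_{k,k}'x_k+\vartheta_k$, $\vartheta_k\sim\mathcal N(0,\Theta_k)$, with $$L_{k,k}=\bar U_k\begin{bmatrix}\bar\Lambda_k^{-1/2}U_k\Lambda_k^o&O\\O&O\end{bmatrix},\quad\Lambda_k^o=\mathrm{diag}(\lambda^o_{k,1},\dots,\lambda^o_{k,t_k}),\quad\Theta_k=\mathrm{diag}(\theta_{k,1}^2,\dots,\theta_{k,t_k}^2,0,\dots,0),$$ satisfies $H_k=S_k$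 for all $k=1,\dots,\kappa$, under every control policy. -/

import Mathlib

open MeasureTheory ProbabilityTheory
open scoped Matrix

universe u

noncomputable section

/-- Euclidean space of column vectors of length `n`. -/
abbrev Vec (n : ℕ) : Type := EuclideanSpace ℝ (Fin n)

/-- The matrix-vector product `M x`. -/
def matVec {a b : ℕ} (M : Matrix (Fin a) (Fin b) ℝ) (x : Vec b) : Vec a :=
  WithLp.toLp 2 (M *ᵥ WithLp.ofLp x)

/-- Parameters of the Gauss-Markov plant `x_{k+1} = A x_k + B u_k + w_k`, with
`x_1 ∼ N(0, Σ₁)` and `w_k ∼ N(0, Σ_w)`. -/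
structure Plant (m r : ℕ) where
  /-- state matrix -/
  A : Matrix (Fin m) (Fin m) ℝ
  /-- input matrix -/
  B : Matrix (Fin m) (Fin r) ℝ
  /-- covariance of the initial state -/
  initCov : Matrix (Fin m) (Fin m) ℝ
  /-- covariance of the state noise -/
  stepCov : Matrix (Fin m) (Fin m) ℝ
  initCov_psd : initCov.PosSemidef
  stepCov_psd : stepCov.PosSemidef

/-- A linear-plus-noise signaling rule (the sensor observes the state perfectly):
`s_k = ∑_{j ≤ k} L_{k,j}' x_j + ϑ_k` with `ϑ_k ∼ N(0, Θ_k)`, where the gains `L_{k,j}` are arbitrary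
and the `Θ_k` are arbitrary positive semi-definite matrices.
Stages are numbered from `0`: index `k` is the `(k+1)`-st stage. -/
structure SignalingRule (m : ℕ) where
  /-- `gain k j` is `L_{k,j}`; only `j ≤ k` is ever used -/
  gain : ℕ → ℕ → Matrix (Fin m) (Fin m) ℝ
  /-- `noiseCov k` is `Θ_k` -/
  noiseCov : ℕ → Matrix (Fin m) (Fin m) ℝ
  noiseCov_psd : ∀ k, (noiseCov k).PosSemidef

/-- The rule is memoryless up to the horizon `κ`: `s_k = L_{k,k}' x_k + ϑ_k`. -/
def SignalingRule.IsMemoryless {m : ℕ} (η : SignalingRule m) (κ : ℕ) : Prop :=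
  ∀ k < κ, ∀ j < k, η.gain k j = 0

/-- A control policy: Borel measurable maps `u_k = γ_k(s_{1:k})`. -/
structure ControlPolicy (m r : ℕ) where
  /-- the map used at the stage with index `k`, where `k + 1` signals are available -/
  act : (k : ℕ) → (Fin (k + 1) → Vec m) → Vec r
  measurable_act : ∀ k, Measurable (act k)

/-- A realization, over the horizon `κ` and on the probability space `(Ω, μ)`, of the plant `P` in
closed loop with the signaling rule `η` and the control policy `γ`. -/
structure ClosedLoop {m r : ℕ} (P : Plant m r) (κ : ℕ) (η : SignalingRule m)
    (γ : ControlPolicy m r) {Ω : Type u} [MeasurableSpace Ω] (μ : Measure Ω) where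
  /-- state -/
  x : ℕ → Ω → Vec m
  /-- control input -/
  u : ℕ → Ω → Vec r
  /-- state noise -/
  w : ℕ → Ω → Vec m
  /-- signal -/
  s : ℕ → Ω → Vec m
  /-- signaling noise -/
  v : ℕ → Ω → Vec m
  measurable_init : Measurable (x 0)
  measurable_w : ∀ k < κ, Measurable (w k)
  measurable_v : ∀ k < κ, Measurable (v k)
  measurable_s : ∀ k < κ, Measurable (s k)
  init_law : HasLaw (x 0) (multivariateGaussian 0 P.initCov) μ
  w_law : ∀ k < κ, HasLaw (w k) (multivariateGaussian 0 P.stepCov) μ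
  v_law : ∀ k < κ, HasLaw (v k) (multivariateGaussian 0 (η.noiseCov k)) μ
  /-- initial state, state noises and signaling noises are mutually independent -/
  indep : iIndepFun (Sum.elim (fun _ : Unit => x 0)
    (Sum.elim (fun k : Fin κ => w k) (fun k : Fin κ => v k))) μ
  state_eq : ∀ k < κ, ∀ᵐ ω ∂μ,
    x (k + 1) ω = matVec P.A (x k ω) + matVec P.B (u k ω) + w k ω
  signal_eq : ∀ k < κ, ∀ᵐ ω ∂μ,
    s k ω = ∑ j ∈ Finset.range (k + 1), matVec (η.gain k j)ᵀ (x j ω) + v k ω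
  control_eq : ∀ k < κ, ∀ᵐ ω ∂μ, u k ω = γ.act k (fun j => s j ω)

/-- The covariance matrix of a random vector. -/
def covMatrix {Ω : Type u} [MeasurableSpace Ω] {m : ℕ} (μ : Measure Ω) (X : Ω → Vec m) :
    Matrix (Fin m) (Fin m) ℝ :=
  Matrix.of fun i j => cov[fun ω => X ω i, fun ω => X ω j; μ]

/-- The second moment matrix `E[X X']` of a random vector. -/
def secondMoment {Ω : Type u} [MeasurableSpace Ω] {m : ℕ} (μ : Measure Ω) (X : Ω → Vec m) :
    Matrix (Fin m) (Fin m) ℝ :=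
  Matrix.of fun i j => ∫ ω, X ω i * X ω j ∂μ

namespace ClosedLoop

variable {m r : ℕ} {P : Plant m r} {κ : ℕ} {η : SignalingRule m} {γ : ControlPolicy m r}
  {Ω : Type u} [MeasurableSpace Ω] {μ : Measure Ω}

/-- The control-free state: `x_1^o = x_1`, `x_{k+1}^o = A x_k^o + w_k`. -/
def free (c : ClosedLoop P κ η γ μ) : ℕ → Ω → Vec m
  | 0 => c.x 0
  | k + 1 => fun ω => matVec P.A (c.free k ω) + c.w k ω

/-- The σ-algebra generated by the signals `s_{1:k}`. -/
abbrev signalAlgebra (c : ClosedLoop P κ η γ μ) (k : ℕ) : MeasurableSpace Ω :=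
  MeasurableSpace.comap (fun ω (j : Fin (k + 1)) => c.s j ω) inferInstance

/-- `H_k = cov(E[x_k^o | s_{1:k}])`. -/
def posteriorCov (c : ClosedLoop P κ η γ μ) (k : ℕ) : Matrix (Fin m) (Fin m) ℝ :=
  covMatrix μ (μ[c.free k | c.signalAlgebra k])

end ClosedLoop

namespace Plant

variable {m r : ℕ}

/-- The covariance `Σ_k^o` of the control-free state: `Σ_1^o = Σ₁`,
`Σ_{k+1}^o = A Σ_k^o A' + Σ_w`. -/
def freeCov (P : Plant m r) : ℕ → Matrix (Fin m) (Fin m) ℝ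
  | 0 => P.initCov
  | k + 1 => P.A * P.freeCov k * P.Aᵀ + P.stepCov

/-- `A S_{k-1} A'`, which is read as `O` at the first stage. -/
def predCov (P : Plant m r) (S : ℕ → Matrix (Fin m) (Fin m) ℝ) : ℕ → Matrix (Fin m) (Fin m) ℝ
  | 0 => 0
  | k + 1 => P.A * S k * P.Aᵀ

/-- The linear matrix inequalities `Σ_1^o ⪰ H_1 ⪰ O` and
`Σ_k^o ⪰ H_k ⪰ A H_{k-1} A'` for `1 < k ≤ κ`. -/
def SatisfiesLMI (P : Plant m r) (κ : ℕ) (H : ℕ → Matrix (Fin m) (Fin m) ℝ) : Prop :=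
  (0 < κ → (P.freeCov 0 - H 0).PosSemidef ∧ (H 0).PosSemidef) ∧
  ∀ k, k + 1 < κ →
    (P.freeCov (k + 1) - H (k + 1)).PosSemidef ∧
    (H (k + 1) - P.A * H k * P.Aᵀ).PosSemidef

end Plant

/-- The `m × t` matrix `[I; O]`. For `t ≤ m` and a `t × t` matrix `M`, the product
`colEmb m t * M * (colEmb m t)ᵀ` is the `m × m` block matrix `[M O; O O]`. -/
def colEmb (m t : ℕ) : Matrix (Fin m) (Fin t) ℝ :=
  Matrix.of fun i j => if (i : ℕ) = (j : ℕ) then 1 else 0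

/-- Spectral data for a pair `D = Σ_k^o - A S_{k-1} A'`, `R = S_k - A S_{k-1} A'`:
an eigen-decomposition `D = Ū [Λ̄ O; O O] Ū'` with `Λ̄` diagonal and positive definite of size
`t = rank D`, and an eigen-decomposition `T = U Λ U'` of the normalized matrix
`T = [Λ̄^{-1/2} O] Ū' R Ū [Λ̄^{-1/2}; O]`. -/
structure SpectralData {m : ℕ} (D R : Matrix (Fin m) (Fin m) ℝ) where
  t : ℕ
  t_eq_rank : t = D.rank
  /-- `Ū` -/
  Ubar : Matrix (Fin m) (Fin m) ℝ
  /-- diagonal of `Λ̄` -/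
  lamBar : Fin t → ℝ
  /-- `U` -/
  U : Matrix (Fin t) (Fin t) ℝ
  /-- diagonal of `Λ`, the eigenvalues of `T` -/
  lam : Fin t → ℝ
  Ubar_mem : Ubar ∈ Matrix.orthogonalGroup (Fin m) ℝ
  lamBar_pos : ∀ i, 0 < lamBar i
  D_eq : D = Ubar * (colEmb m t * Matrix.diagonal lamBar * (colEmb m t)ᵀ) * Ubarᵀ
  U_mem : U ∈ Matrix.orthogonalGroup (Fin t) ℝ
  T_eq : (Matrix.diagonal (fun i => (Real.sqrt (lamBar i))⁻¹) * (colEmb m t)ᵀ) * Ubarᵀ * R * Ubar *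
      (colEmb m t * Matrix.diagonal (fun i => (Real.sqrt (lamBar i))⁻¹)) =
    U * Matrix.diagonal lam * Uᵀ

namespace SpectralData

variable {m : ℕ} {D R : Matrix (Fin m) (Fin m) ℝ}

/-- Scalars `a = (λ_i^o)_i` and `b = (θ_i)_i` with `a_i² / (a_i² + b_i²) = λ_i` for all `i`. -/
def IsWeights (d : SpectralData D R) (a b : Fin d.t → ℝ) : Prop :=
  ∀ i, 0 < a i ^ 2 + b i ^ 2 ∧ a i ^ 2 / (a i ^ 2 + b i ^ 2) = d.lam i

/-- The gain `Ū [Λ̄^{-1/2} U Λ^o  O; O O]` with `Λ^o = diag a`. -/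
def gain (d : SpectralData D R) (a : Fin d.t → ℝ) : Matrix (Fin m) (Fin m) ℝ :=
  d.Ubar * (colEmb m d.t *
    (Matrix.diagonal (fun i => (Real.sqrt (d.lamBar i))⁻¹) * d.U * Matrix.diagonal a) *
    (colEmb m d.t)ᵀ)

/-- The noise covariance `diag(b_1², …, b_t², 0, …, 0)`. -/
def noise (d : SpectralData D R) (b : Fin d.t → ℝ) : Matrix (Fin m) (Fin m) ℝ :=
  colEmb m d.t * Matrix.diagonal (fun i => b i ^ 2) * (colEmb m d.t)ᵀ

end SpectralData

/-- `Σ_k^o - A S_{k-1} A'` and `S_k - A S_{k-1} A'` have the given type of spectral data. -/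
abbrev StageData {m r : ℕ} (P : Plant m r) (S : ℕ → Matrix (Fin m) (Fin m) ℝ) (k : ℕ) : Type :=
  SpectralData (P.freeCov k - P.predCov S k) (S k - P.predCov S k)

/-- `η` is, over the horizon `κ`, a rule `s_k = L_{k,k}' x_k + ϑ_k` whose gains and noise covariances
are built from spectral data of `S` (some choice of the eigen-decompositions and of the weights). -/
def IsSpectralRule {m r : ℕ} (P : Plant m r) (κ : ℕ) (S : ℕ → Matrix (Fin m) (Fin m) ℝ)
    (η : SignalingRule m) : Prop :=
  η.IsMemoryless κ ∧
  ∀ k < κ, ∃ (d : StageData P S k) (a b : Fin d.t → ℝ),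
    d.IsWeights a b ∧ η.gain k k = d.gain a ∧ η.noiseCov k = d.noise b

end

/-! Control does not change the information. The difference x_k - x_k^o is a function of the earlier
signals, so the signals and their control-free versions `freeSignal` determine each other, stage by
stage and up to null sets (`aestronglyMeasurable_signal`, `aestronglyMeasurable_freeSignal`).

Necessity needs no Gaussian filtering. The law of total variance gives Σ_k^o ⪰ H_k. The noise w_k is
centered and independent of s_{1:k}, so predicting x_{k+1}^o from s_{1:k} gives A E[x_k^o |
s_{1:k}], with covariance A H_k A' (`covMatrix_prediction`). Conditioning the same vector on one
more signal can only increase the covariance of the conditional mean.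

Sufficiency is a Kalman filter with prescribed covariances. If the predicted estimate has covariance
A S_{k-1} A', its error has covariance D = Σ_k^o - A S_{k-1} A', and the update must add R = S_k - A
S_{k-1} A'. The matrix W = Ū [Λ̄^{-1/2}; O] U satisfies W'DW = 1 and W'RW = Λ, so the signal splits
into scalar channels with gain a_i and noise b_i, each explaining the fraction a_i²/(a_i²+b_i²) =
λ_i of a unit variance (`exists_estimator`). The steps `IsBestEstimate.predict` and
`IsBestEstimate.update` propagate this. Joint Gaussianity turns the uncorrelated residual into an
independent one, so the linear estimate is the posterior mean (`IsBestEstimate.posteriorCov_eq`). -/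

noncomputable section

/-! ### Second order calculus of random vectors -/

section CrossCovariance

variable {Ω : Type u} [MeasurableSpace Ω] {μ : Measure Ω} {a b n : ℕ}

/-- Multiplication by a matrix as a continuous linear map. -/
def matVecCLM (M : Matrix (Fin a) (Fin b) ℝ) : Vec b →L[ℝ] Vec a :=
  LinearMap.toContinuousLinearMap (Matrix.toLpLin 2 2 M)

lemma matVec_apply (M : Matrix (Fin a) (Fin b) ℝ) (x : Vec b) (i : Fin a) :
    matVec M x i = ∑ j, M i j * x j := rfl

lemma matVec_add (M : Matrix (Fin a) (Fin b) ℝ) (x y : Vec b) :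
    matVec M (x + y) = matVec M x + matVec M y := map_add (matVecCLM M) x y

lemma matVec_sub (M : Matrix (Fin a) (Fin b) ℝ) (x y : Vec b) :
    matVec M (x - y) = matVec M x - matVec M y := map_sub (matVecCLM M) x y

lemma matVec_sum {ι : Type*} (M : Matrix (Fin a) (Fin b) ℝ) (s : Finset ι) (x : ι → Vec b) :
    matVec M (∑ i ∈ s, x i) = ∑ i ∈ s, matVec M (x i) := map_sum (matVecCLM M) x s

lemma matVec_zero_left (x : Vec b) : matVec (0 : Matrix (Fin a) (Fin b) ℝ) x = 0 := by
  simp [matVec]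

lemma matVec_matVec (M : Matrix (Fin a) (Fin n) ℝ) (N : Matrix (Fin n) (Fin b) ℝ) (x : Vec b) :
    matVec M (matVec N x) = matVec (M * N) x := by
  simp [matVec]

lemma matVec_sub_left (M N : Matrix (Fin a) (Fin b) ℝ) (x : Vec b) :
    matVec (M - N) x = matVec M x - matVec N x := by
  simp [matVec, Matrix.sub_mulVec]

lemma measurable_matVec (M : Matrix (Fin a) (Fin b) ℝ) : Measurable (matVec M) :=
  (matVecCLM M).continuous.measurable

lemma continuous_matVec (M : Matrix (Fin a) (Fin b) ℝ) : Continuous (matVec M) :=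
  (matVecCLM M).continuous

lemma MeasureTheory.MemLp.matVec {X : Ω → Vec b} (hX : MemLp X 2 μ)
    (M : Matrix (Fin a) (Fin b) ℝ) : MemLp (fun ω => matVec M (X ω)) 2 μ :=
  (matVecCLM M).comp_memLp' hX

/-- The matrix of the covariances between the coordinates of two random vectors. -/
def crossCov (μ : Measure Ω) (X : Ω → Vec a) (Y : Ω → Vec b) : Matrix (Fin a) (Fin b) ℝ :=
  Matrix.of fun i j => cov[fun ω => X ω i, fun ω => Y ω j; μ]

lemma covMatrix_eq_crossCov (X : Ω → Vec a) : covMatrix μ X = crossCov μ X X := rfl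

lemma crossCov_apply (X : Ω → Vec a) (Y : Ω → Vec b) (i : Fin a) (j : Fin b) :
    crossCov μ X Y i j = cov[fun ω => X ω i, fun ω => Y ω j; μ] := rfl

lemma crossCov_transpose (X : Ω → Vec a) (Y : Ω → Vec b) :
    (crossCov μ X Y)ᵀ = crossCov μ Y X := by
  ext i j
  exact covariance_comm _ _

lemma crossCov_congr {X X' : Ω → Vec a} {Y Y' : Ω → Vec b} (hX : X =ᵐ[μ] X') (hY : Y =ᵐ[μ] Y') :
    crossCov μ X Y = crossCov μ X' Y' := by
  ext i j
  have h1 : (fun ω => X ω i) =ᵐ[μ] fun ω => X' ω i := hX.fun_comp fun x => x i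
  have h2 : (fun ω => Y ω j) =ᵐ[μ] fun ω => Y' ω j := hY.fun_comp fun y => y j
  simp only [crossCov, Matrix.of_apply, covariance]
  rw [integral_congr_ae h1, integral_congr_ae h2]
  refine integral_congr_ae ?_
  filter_upwards [h1, h2] with ω e1 e2
  rw [e1, e2]

lemma covMatrix_congr {X X' : Ω → Vec a} (hX : X =ᵐ[μ] X') : covMatrix μ X = covMatrix μ X' :=
  crossCov_congr hX hX

lemma crossCov_zero_left (Y : Ω → Vec b) : crossCov μ (fun _ => (0 : Vec a)) Y = 0 := by
  ext i j
  exact covariance_zero_left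

lemma ProbabilityTheory.IndepFun.crossCov_eq_zero {X : Ω → Vec a} {Y : Ω → Vec b}
    (h : IndepFun X Y μ) (hX : MemLp X 2 μ) (hY : MemLp Y 2 μ) : crossCov μ X Y = 0 := by
  ext i j
  exact IndepFun.covariance_eq_zero
    (h.comp (φ := fun x : Vec a => x i) (ψ := fun y : Vec b => y j) (by fun_prop) (by fun_prop))
    (hX.eval_piLp i) (hY.eval_piLp j)

lemma isHermitian_covMatrix (X : Ω → Vec a) : (covMatrix μ X).IsHermitian := by
  rw [Matrix.IsHermitian, Matrix.conjTranspose_eq_transpose_of_trivial, covMatrix_eq_crossCov,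
    crossCov_transpose]

lemma covMatrix_of_hasLaw {X : Ω → Vec a} {S : Matrix (Fin a) (Fin a) ℝ} (hS : S.PosSemidef)
    (hX : HasLaw X (multivariateGaussian 0 S) μ) : covMatrix μ X = S := by
  ext i j
  have := hX.covariance_fun_comp (f := fun x => x i) (g := fun x => x j) (by fun_prop) (by fun_prop)
  rw [covMatrix, Matrix.of_apply, this, covariance_eval_multivariateGaussian hS]

lemma integral_eq_zero_of_hasLaw {X : Ω → Vec a} {S : Matrix (Fin a) (Fin a) ℝ}
    (hX : HasLaw X (multivariateGaussian 0 S) μ) : ∫ ω, X ω ∂μ = 0 := by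
  rw [hX.integral_eq, integral_id_multivariateGaussian]

variable [IsProbabilityMeasure μ]

lemma crossCov_add_left {X Y : Ω → Vec a} {Z : Ω → Vec b}
    (hX : MemLp X 2 μ) (hY : MemLp Y 2 μ) (hZ : MemLp Z 2 μ) :
    crossCov μ (fun ω => X ω + Y ω) Z = crossCov μ X Z + crossCov μ Y Z := by
  ext i j
  exact covariance_add_left (hX.eval_piLp i) (hY.eval_piLp i) (hZ.eval_piLp j)

lemma crossCov_sub_left {X Y : Ω → Vec a} {Z : Ω → Vec b}
    (hX : MemLp X 2 μ) (hY : MemLp Y 2 μ) (hZ : MemLp Z 2 μ) :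
    crossCov μ (fun ω => X ω - Y ω) Z = crossCov μ X Z - crossCov μ Y Z := by
  ext i j
  exact covariance_sub_left (hX.eval_piLp i) (hY.eval_piLp i) (hZ.eval_piLp j)

lemma crossCov_add_right {X Y : Ω → Vec a} {Z : Ω → Vec b}
    (hX : MemLp X 2 μ) (hY : MemLp Y 2 μ) (hZ : MemLp Z 2 μ) :
    crossCov μ Z (fun ω => X ω + Y ω) = crossCov μ Z X + crossCov μ Z Y := by
  ext i j
  exact covariance_add_right (hZ.eval_piLp i) (hX.eval_piLp j) (hY.eval_piLp j)

lemma crossCov_matVec_left {X : Ω → Vec n} {Y : Ω → Vec b} (hX : MemLp X 2 μ) (hY : MemLp Y 2 μ)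
    (M : Matrix (Fin a) (Fin n) ℝ) :
    crossCov μ (fun ω => matVec M (X ω)) Y = M * crossCov μ X Y := by
  ext i j
  simp only [crossCov_apply, matVec_apply, Matrix.mul_apply]
  rw [covariance_fun_sum_left (fun l => (hX.eval_piLp l).const_mul _) (hY.eval_piLp j)]
  simp only [covariance_const_mul_left]

lemma crossCov_matVec_right {X : Ω → Vec n} {Y : Ω → Vec b} (hX : MemLp X 2 μ) (hY : MemLp Y 2 μ)
    (M : Matrix (Fin a) (Fin b) ℝ) :
    crossCov μ X (fun ω => matVec M (Y ω)) = crossCov μ X Y * Mᵀ := by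
  rw [← crossCov_transpose, crossCov_matVec_left hY hX, Matrix.transpose_mul, crossCov_transpose]

lemma crossCov_sum_right {ι : Type*} (s : Finset ι) {X : Ω → Vec a} {Y : ι → Ω → Vec b}
    (hX : MemLp X 2 μ) (hY : ∀ i ∈ s, MemLp (Y i) 2 μ) :
    crossCov μ X (fun ω => ∑ i ∈ s, Y i ω) = ∑ i ∈ s, crossCov μ X (Y i) := by
  ext i j
  simp only [crossCov_apply, Matrix.sum_apply, WithLp.ofLp_sum, Finset.sum_apply]
  exact covariance_fun_sum_right' (fun l hl => (hY l hl).eval_piLp j) (hX.eval_piLp i)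

lemma covMatrix_matVec {X : Ω → Vec n} (hX : MemLp X 2 μ) (M : Matrix (Fin a) (Fin n) ℝ) :
    covMatrix μ (fun ω => matVec M (X ω)) = M * covMatrix μ X * Mᵀ := by
  rw [covMatrix_eq_crossCov, crossCov_matVec_left hX (hX.matVec M), crossCov_matVec_right hX hX,
    ← Matrix.mul_assoc, covMatrix_eq_crossCov]

lemma covMatrix_add {X Y : Ω → Vec a} (hX : MemLp X 2 μ) (hY : MemLp Y 2 μ)
    (h : crossCov μ X Y = 0) :
    covMatrix μ (fun ω => X ω + Y ω) = covMatrix μ X + covMatrix μ Y := by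
  have h' : crossCov μ Y X = 0 := by rw [← crossCov_transpose, h, Matrix.transpose_zero]
  rw [covMatrix_eq_crossCov, crossCov_add_left hX hY (Z := fun ω => X ω + Y ω) (hX.add hY),
    crossCov_add_right hX hY hX,
    crossCov_add_right hX hY hY, h, h', add_zero, zero_add]
  rfl

/-- Continuous linear functionals of uncorrelated random vectors are uncorrelated. -/
lemma covariance_strongDual_eq_zero {X : Ω → Vec a} {Y : Ω → Vec b} (hX : MemLp X 2 μ)
    (hY : MemLp Y 2 μ) (h : crossCov μ X Y = 0) (L : Vec a →L[ℝ] ℝ) (L' : Vec b →L[ℝ] ℝ) :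
    cov[fun ω => L (X ω), fun ω => L' (Y ω); μ] = 0 := by
  have key : ∀ (c : ℕ) (l : Vec c →L[ℝ] ℝ) (x : Vec c),
      l x = ∑ i, x i * l (EuclideanSpace.single i 1) := fun c l x => by
    conv_lhs => rw [← (EuclideanSpace.basisFun (Fin c) ℝ).sum_repr x, map_sum]
    simp only [map_smul, smul_eq_mul, EuclideanSpace.basisFun_apply, EuclideanSpace.basisFun_repr]
  have hL : (fun ω => L (X ω)) = fun ω => ∑ i, X ω i * L (EuclideanSpace.single i 1) :=
    funext fun ω => key a L _
  have hL' : (fun ω => L' (Y ω)) = fun ω => ∑ i, Y ω i * L' (EuclideanSpace.single i 1) :=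
    funext fun ω => key b L' _
  rw [hL, hL', covariance_fun_sum_fun_sum (fun i => (hX.eval_piLp i).mul_const _)
    (fun i => (hY.eval_piLp i).mul_const _)]
  refine Finset.sum_eq_zero fun i _ => Finset.sum_eq_zero fun j _ => ?_
  rw [covariance_mul_const_left, covariance_mul_const_right, ← crossCov_apply, h]
  simp

/-- The quadratic form of a covariance matrix. -/
lemma dotProduct_covMatrix_mulVec {X : Ω → Vec a} (hX : MemLp X 2 μ) (z : Fin a → ℝ) :
    z ⬝ᵥ covMatrix μ X *ᵥ z = Var[fun ω => inner ℝ (WithLp.toLp 2 z) (X ω); μ] := by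
  have h1 : (fun ω => inner ℝ (WithLp.toLp 2 z) (X ω)) = fun ω => ∑ i, z i * X ω i := by
    funext ω
    simp [PiLp.inner_apply, mul_comm]
  have hm : ∀ i, MemLp (fun ω => z i * X ω i) 2 μ := fun i => (hX.eval_piLp i).const_mul _
  rw [h1, ← covariance_self (memLp_finsetSum _ fun i _ => hm i).aemeasurable,
    covariance_fun_sum_fun_sum hm hm]
  simp only [dotProduct, Matrix.mulVec, Finset.mul_sum, covariance_const_mul_left,
    covariance_const_mul_right, covMatrix, Matrix.of_apply]
  exact Finset.sum_congr rfl fun i _ => Finset.sum_congr rfl fun j _ => by ring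

lemma posSemidef_covMatrix {X : Ω → Vec a} (hX : MemLp X 2 μ) : (covMatrix μ X).PosSemidef := by
  refine Matrix.PosSemidef.of_dotProduct_mulVec_nonneg (isHermitian_covMatrix X) fun z => ?_
  rw [star_trivial, dotProduct_covMatrix_mulVec hX]
  exact variance_nonneg _ _

lemma secondMoment_eq_covMatrix {X : Ω → Vec a} (hX : MemLp X 2 μ) (h0 : ∫ ω, X ω ∂μ = 0) :
    secondMoment μ X = covMatrix μ X := by
  have h : ∀ i, ∫ ω, X ω i ∂μ = 0 := fun i => by
    have := (EuclideanSpace.proj (𝕜 := ℝ) i).integral_comp_comm (hX.integrable one_le_two)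
    simpa [h0] using this
  ext i j
  simp only [secondMoment, covMatrix, Matrix.of_apply]
  rw [covariance_eq_sub (hX.eval_piLp i) (hX.eval_piLp j), h i]
  simp

lemma integral_matVec {X : Ω → Vec b} (hX : MemLp X 2 μ) (M : Matrix (Fin a) (Fin b) ℝ) :
    ∫ ω, matVec M (X ω) ∂μ = matVec M (∫ ω, X ω ∂μ) :=
  (matVecCLM M).integral_comp_comm (hX.integrable one_le_two)

end CrossCovariance

/-! ### Covariance of conditional expectations -/

section ConditionalCovariance

variable {Ω : Type u} {m₁ m₂ m₀ : MeasurableSpace Ω} {μ : Measure[m₀] Ω}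
  [IsProbabilityMeasure μ] {a : ℕ}

/-- Law of total variance: the gap is the mean of the conditional variance, which is nonnegative. -/
lemma variance_condExp_le (hm : m₁ ≤ m₀) {X : Ω → ℝ} (hX : MemLp X 2 μ) :
    Var[μ[X | m₁]; μ] ≤ Var[X; μ] := by
  rw [← integral_condVar_add_variance_condExp hm hX]
  refine le_add_of_nonneg_left (integral_nonneg_of_ae ?_)
  exact condExp_nonneg (.of_forall fun ω => sq_nonneg _)

/-- Conditioning decreases the covariance matrix. -/
lemma posSemidef_covMatrix_sub_condExp (hm : m₁ ≤ m₀) {X : Ω → Vec a} (hX : MemLp X 2 μ) :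
    (covMatrix μ X - covMatrix μ (μ[X | m₁])).PosSemidef := by
  refine Matrix.PosSemidef.of_dotProduct_mulVec_nonneg
    ((isHermitian_covMatrix X).sub (isHermitian_covMatrix _)) fun z => ?_
  rw [star_trivial, Matrix.sub_mulVec, dotProduct_sub, dotProduct_covMatrix_mulVec hX,
    dotProduct_covMatrix_mulVec (hX.condExp one_le_two), sub_nonneg]
  -- Projecting on `z` commutes with conditioning, which reduces the matrix inequality to the scalar
  -- one.
  have hc := (innerSL ℝ (WithLp.toLp 2 z)).comp_condExp_comm (m := m₁)
    (hX.integrable one_le_two)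
  calc Var[fun ω => inner ℝ (WithLp.toLp 2 z) ((μ[X | m₁]) ω); μ]
      = Var[μ[fun ω => inner ℝ (WithLp.toLp 2 z) (X ω) | m₁]; μ] := variance_congr hc
    _ ≤ _ := variance_condExp_le hm
        ((innerSL ℝ (WithLp.toLp 2 z)).comp_memLp' hX)

/-- Tower property: the coarser conditional mean is the conditional mean of the finer one. -/
lemma posSemidef_covMatrix_condExp_sub_condExp (h₁₂ : m₁ ≤ m₂) (hm : m₂ ≤ m₀)
    {X : Ω → Vec a} (hX : MemLp X 2 μ) :
    (covMatrix μ (μ[X | m₂]) - covMatrix μ (μ[X | m₁])).PosSemidef := by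
  rw [← covMatrix_congr (condExp_condExp_of_le h₁₂ hm)]
  exact posSemidef_covMatrix_sub_condExp (h₁₂.trans hm) (hX.condExp one_le_two)

end ConditionalCovariance

/-! ### Linear algebra of spectral data -/

lemma colEmb_transpose_mul_self {m t : ℕ} (h : t ≤ m) : (colEmb m t)ᵀ * colEmb m t = 1 := by
  ext i j
  rw [Matrix.mul_apply, Finset.sum_eq_single (Fin.castLE h i)]
  · simp [colEmb, Fin.ext_iff, Matrix.one_apply]
  · intro b _ hb
    have : (b : ℕ) ≠ i := fun h' => hb (Fin.ext h')
    simp [colEmb, this]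
  · simp

/-- If `O ⪯ R ⪯ D`, then the kernel of `D` is contained in that of `R`. -/
lemma mul_eq_zero_of_posSemidef {m n : ℕ} {D R : Matrix (Fin m) (Fin m) ℝ} (hR : R.PosSemidef)
    (hDR : (D - R).PosSemidef) {Q : Matrix (Fin m) (Fin n) ℝ} (hQ : D * Q = 0) : R * Q = 0 := by
  have hcol : ∀ z : Fin n → ℝ, R *ᵥ (Q *ᵥ z) = 0 := fun z => by
    -- The form of `R` at `Q z` is squeezed between 0 and that of `D`, which vanishes; a positive
    -- semi-definite matrix kills every vector on which its form vanishes.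
    rw [← hR.dotProduct_mulVec_zero_iff]
    refine le_antisymm ?_ (hR.dotProduct_mulVec_nonneg _)
    have h := hDR.dotProduct_mulVec_nonneg (Q *ᵥ z)
    rw [Matrix.sub_mulVec, dotProduct_sub, Matrix.mulVec_mulVec z D Q, hQ] at h
    simpa using h
  ext i j
  have := congrFun (hcol (Pi.single j 1)) i
  rw [Matrix.mulVec_mulVec, Matrix.mulVec_single_one] at this
  simpa using this

namespace SpectralData

variable {m : ℕ} {D R : Matrix (Fin m) (Fin m) ℝ}

lemma t_le (d : SpectralData D R) : d.t ≤ m :=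
  d.t_eq_rank ▸ D.rank_le_width

/-- The columns of `Ū` that span the range of `D`. -/
def frame (d : SpectralData D R) : Matrix (Fin m) (Fin d.t) ℝ := d.Ubar * colEmb m d.t

/-- The diagonal matrix `Λ̄^{-1/2}`. -/
def invSqrt (d : SpectralData D R) : Matrix (Fin d.t) (Fin d.t) ℝ :=
  Matrix.diagonal fun i => (Real.sqrt (d.lamBar i))⁻¹

/-- The diagonal matrix `Λ̄^{1/2}`. -/
def sqrt (d : SpectralData D R) : Matrix (Fin d.t) (Fin d.t) ℝ :=
  Matrix.diagonal fun i => Real.sqrt (d.lamBar i)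

lemma colEmb_orthonormal (d : SpectralData D R) : (colEmb m d.t)ᵀ * colEmb m d.t = 1 :=
  colEmb_transpose_mul_self d.t_le

lemma frame_orthonormal (d : SpectralData D R) : d.frameᵀ * d.frame = 1 := by
  have h : d.Ubarᵀ * d.Ubar = 1 := (Matrix.mem_orthogonalGroup_iff' _ _).1 d.Ubar_mem
  rw [frame, Matrix.transpose_mul, Matrix.mul_assoc, ← Matrix.mul_assoc _ d.Ubar, h, Matrix.one_mul,
    d.colEmb_orthonormal]

lemma U_transpose_mul (d : SpectralData D R) : d.Uᵀ * d.U = 1 :=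
  (Matrix.mem_orthogonalGroup_iff' _ _).1 d.U_mem

lemma sqrt_mul_invSqrt (d : SpectralData D R) : d.sqrt * d.invSqrt = 1 := by
  rw [sqrt, invSqrt, Matrix.diagonal_mul_diagonal, ← Matrix.diagonal_one]
  congr 1
  funext i
  exact mul_inv_cancel₀ (Real.sqrt_pos.2 (d.lamBar_pos i)).ne'

lemma invSqrt_mul_sqrt (d : SpectralData D R) : d.invSqrt * d.sqrt = 1 := by
  rw [← d.sqrt_mul_invSqrt, sqrt, invSqrt, Matrix.diagonal_mul_diagonal,
    Matrix.diagonal_mul_diagonal]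
  simp only [mul_comm]

lemma sqrt_mul_sqrt (d : SpectralData D R) : d.sqrt * d.sqrt = Matrix.diagonal d.lamBar := by
  rw [sqrt, Matrix.diagonal_mul_diagonal]
  congr 1
  funext i
  exact Real.mul_self_sqrt (d.lamBar_pos i).le

lemma transpose_sqrt (d : SpectralData D R) : d.sqrtᵀ = d.sqrt := Matrix.diagonal_transpose _

lemma transpose_invSqrt (d : SpectralData D R) : d.invSqrtᵀ = d.invSqrt :=
  Matrix.diagonal_transpose _

lemma eq_frame (d : SpectralData D R) : D = d.frame * d.sqrt * d.sqrt * d.frameᵀ := by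
  conv_lhs => rw [d.D_eq, ← d.sqrt_mul_sqrt]
  simp only [frame, Matrix.transpose_mul, Matrix.mul_assoc]

lemma mul_eq (d : SpectralData D R) {n : ℕ} (N : Matrix (Fin m) (Fin n) ℝ) :
    D * N = d.frame * d.sqrt * d.sqrt * d.frameᵀ * N :=
  congrArg (· * N) d.eq_frame

lemma normalized_eq (d : SpectralData D R) :
    d.invSqrt * d.frameᵀ * R * d.frame * d.invSqrt = d.U * Matrix.diagonal d.lam * d.Uᵀ := by
  rw [← d.T_eq]
  simp only [frame, invSqrt, Matrix.transpose_mul, Matrix.mul_assoc]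

lemma gain_eq (d : SpectralData D R) (a : Fin d.t → ℝ) :
    d.gain a = d.frame * d.invSqrt * d.U * Matrix.diagonal a * (colEmb m d.t)ᵀ := by
  simp only [gain, frame, invSqrt, Matrix.mul_assoc]

/-- Together with `one_eq`: congruence by `frame * invSqrt * U` diagonalizes the pair
simultaneously, taking `R` to Λ and `D` to the identity. -/
lemma diagonal_lam_eq (d : SpectralData D R) :
    Matrix.diagonal d.lam =
      (d.frame * d.invSqrt * d.U)ᵀ * R * (d.frame * d.invSqrt * d.U) := by
  have h : (d.frame * d.invSqrt * d.U)ᵀ * R * (d.frame * d.invSqrt * d.U) =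
      d.Uᵀ * (d.invSqrt * d.frameᵀ * R * d.frame * d.invSqrt) * d.U := by
    simp only [Matrix.transpose_mul, transpose_invSqrt, Matrix.mul_assoc]
  rw [h, normalized_eq]
  simp only [Matrix.mul_assoc, U_transpose_mul, Matrix.mul_one]
  rw [← Matrix.mul_assoc, U_transpose_mul, Matrix.one_mul]

lemma one_eq (d : SpectralData D R) :
    (1 : Matrix (Fin d.t) (Fin d.t) ℝ) =
      (d.frame * d.invSqrt * d.U)ᵀ * D * (d.frame * d.invSqrt * d.U) := by
  rw [Matrix.mul_assoc _ D, d.mul_eq]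
  calc (1 : Matrix (Fin d.t) (Fin d.t) ℝ)
      = d.Uᵀ * (d.invSqrt * ((d.frameᵀ * d.frame) * (d.sqrt * (d.sqrt *
          ((d.frameᵀ * d.frame) * (d.invSqrt * d.U)))))) := by
        rw [frame_orthonormal, Matrix.one_mul, Matrix.one_mul, ← Matrix.mul_assoc d.sqrt d.invSqrt,
          sqrt_mul_invSqrt, Matrix.one_mul, ← Matrix.mul_assoc d.invSqrt, invSqrt_mul_sqrt,
          Matrix.one_mul, U_transpose_mul]
    _ = _ := by simp only [Matrix.transpose_mul, transpose_invSqrt, Matrix.mul_assoc]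

/-- The eigenvalues of the normalized matrix lie in `[0, 1]` when `O ⪯ R ⪯ D`. -/
lemma lam_mem_Icc (d : SpectralData D R) (hR : R.PosSemidef) (hDR : (D - R).PosSemidef)
    (i : Fin d.t) : d.lam i ∈ Set.Icc (0 : ℝ) 1 := by
  have h0 : (Matrix.diagonal d.lam).PosSemidef := by
    rw [d.diagonal_lam_eq, ← Matrix.conjTranspose_eq_transpose_of_trivial]
    exact hR.conjTranspose_mul_mul_same _
  -- The same congruence carries `D - R` to 1 - Λ.
  have h1 : (1 - Matrix.diagonal d.lam).PosSemidef := by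
    rw [d.diagonal_lam_eq, d.one_eq, ← Matrix.sub_mul, ← Matrix.mul_sub,
      ← Matrix.conjTranspose_eq_transpose_of_trivial]
    exact hDR.conjTranspose_mul_mul_same _
  have e0 := h0.diag_nonneg (i := i)
  have e1 := h1.diag_nonneg (i := i)
  simp only [Matrix.diagonal_apply_eq, Matrix.sub_apply, Matrix.one_apply_eq, sub_nonneg] at e0 e1
  exact ⟨e0, e1⟩

lemma exists_isWeights (d : SpectralData D R) (h : ∀ i, d.lam i ∈ Set.Icc (0 : ℝ) 1) :
    ∃ a b : Fin d.t → ℝ, d.IsWeights a b := by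
  -- Normalized so that a² + b² = 1.
  refine ⟨fun i => Real.sqrt (d.lam i), fun i => Real.sqrt (1 - d.lam i), fun i => ?_⟩
  have h1 : Real.sqrt (d.lam i) ^ 2 = d.lam i := Real.sq_sqrt (h i).1
  have h2 : Real.sqrt (1 - d.lam i) ^ 2 = 1 - d.lam i := Real.sq_sqrt (sub_nonneg.2 (h i).2)
  simp [h1, h2]

lemma posSemidef_noise (d : SpectralData D R) (b : Fin d.t → ℝ) : (d.noise b).PosSemidef := by
  rw [noise, ← Matrix.conjTranspose_eq_transpose_of_trivial]
  exact (Matrix.PosSemidef.diagonal fun i => sq_nonneg (b i)).mul_mul_conjTranspose_same _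

/-- `frame * frameᵀ` is the orthogonal projection onto the range of `D`, and O ⪯ R ⪯ D leaves `R` no
component outside that range. Hence normalizing `R` on this range loses nothing. -/
lemma frame_mul_transpose_mul (d : SpectralData D R) (hR : R.PosSemidef)
    (hDR : (D - R).PosSemidef) : d.frame * d.frameᵀ * R * (d.frame * d.frameᵀ) = R := by
  have hD : D * (1 - d.frame * d.frameᵀ) = 0 := by
    rw [d.mul_eq, Matrix.mul_sub, Matrix.mul_one,
      Matrix.mul_assoc _ d.frameᵀ, ← Matrix.mul_assoc d.frameᵀ,
      frame_orthonormal, Matrix.one_mul, sub_self]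
  have h := mul_eq_zero_of_posSemidef hR hDR hD
  rw [Matrix.mul_sub, Matrix.mul_one, sub_eq_zero] at h
  have hT : Rᵀ = R := by
    rw [← Matrix.conjTranspose_eq_transpose_of_trivial]
    exact hR.isHermitian
  have h' := congrArg Matrix.transpose h
  rw [Matrix.transpose_mul, hT, Matrix.transpose_mul, Matrix.transpose_transpose] at h'
  rw [← h', ← h]

/-- The gain of the linear estimator of a vector with covariance `D` from the signal built from the
spectral data: it solves the normal equations and the estimate has covariance `R`. -/
lemma exists_estimator (d : SpectralData D R) (hR : R.PosSemidef) (hDR : (D - R).PosSemidef)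
    {a b : Fin d.t → ℝ} (hw : d.IsWeights a b) :
    ∃ K : Matrix (Fin m) (Fin m) ℝ,
      K * ((d.gain a)ᵀ * D * d.gain a + d.noise b) = D * d.gain a ∧
      K * ((d.gain a)ᵀ * D * d.gain a + d.noise b) * Kᵀ = R := by
  set E := colEmb m d.t with hE
  have hEE : Eᵀ * E = 1 := d.colEmb_orthonormal
  -- The innovation covariance is diagonal because the congruence turns `D` into the identity. It is
  -- singular when `t < m`.
  have hG : (d.gain a)ᵀ * D * d.gain a + d.noise b =
      E * Matrix.diagonal (fun i => a i ^ 2 + b i ^ 2) * Eᵀ := by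
    have : (d.gain a)ᵀ * D * d.gain a = E * Matrix.diagonal a *
        ((d.frame * d.invSqrt * d.U)ᵀ * D * (d.frame * d.invSqrt * d.U)) *
          Matrix.diagonal a * Eᵀ := by
      rw [gain_eq]
      simp only [Matrix.transpose_mul, Matrix.diagonal_transpose, Matrix.transpose_transpose,
        Matrix.mul_assoc, hE]
    rw [this, ← d.one_eq, Matrix.mul_one, Matrix.mul_assoc E, Matrix.diagonal_mul_diagonal, noise,
      ← Matrix.add_mul, ← Matrix.mul_add, Matrix.diagonal_add]
    simp only [sq]
  have hDL : D * d.gain a = d.frame * d.sqrt * d.U * Matrix.diagonal a * Eᵀ := by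
    rw [gain_eq, d.mul_eq]
    calc _ = d.frame * (d.sqrt * (d.sqrt * ((d.frameᵀ * d.frame) * (d.invSqrt *
          (d.U * (Matrix.diagonal a * Eᵀ)))))) := by simp only [Matrix.mul_assoc, hE]
      _ = _ := by
        rw [frame_orthonormal, Matrix.one_mul, ← Matrix.mul_assoc d.sqrt d.invSqrt,
          sqrt_mul_invSqrt, Matrix.one_mul]
        simp only [Matrix.mul_assoc]
  -- The gain is `D * gain a` times the pseudo-inverse of the innovation covariance: only the first
  -- `t` entries are inverted, where a² + b² > 0.
  have hK : d.frame * d.sqrt * d.U * Matrix.diagonal (fun i => a i / (a i ^ 2 + b i ^ 2)) * Eᵀ *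
      (E * Matrix.diagonal (fun i => a i ^ 2 + b i ^ 2) * Eᵀ) =
      d.frame * d.sqrt * d.U * Matrix.diagonal a * Eᵀ := by
    calc _ = d.frame * d.sqrt * d.U * (Matrix.diagonal (fun i => a i / (a i ^ 2 + b i ^ 2)) *
          ((Eᵀ * E) * Matrix.diagonal (fun i => a i ^ 2 + b i ^ 2))) * Eᵀ := by
          simp only [Matrix.mul_assoc]
      _ = _ := by
        rw [hEE, Matrix.one_mul, Matrix.diagonal_mul_diagonal]
        congr 3
        funext i
        exact div_mul_cancel₀ _ (hw i).1.ne'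
  refine ⟨d.frame * d.sqrt * d.U * Matrix.diagonal (fun i => a i / (a i ^ 2 + b i ^ 2)) * Eᵀ,
    ?_, ?_⟩
  · rw [hG, hK, hDL]
  · rw [hG, hK]
    calc _ = d.frame * d.sqrt * (d.U * (Matrix.diagonal a * ((Eᵀ * E) *
          Matrix.diagonal (fun i => a i / (a i ^ 2 + b i ^ 2)))) * d.Uᵀ) * d.sqrt * d.frameᵀ := by
          simp only [Matrix.transpose_mul, Matrix.diagonal_transpose, Matrix.transpose_transpose,
            Matrix.mul_assoc, transpose_sqrt]
      _ = d.frame * d.sqrt * (d.U * Matrix.diagonal d.lam * d.Uᵀ) * d.sqrt * d.frameᵀ := by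
        rw [hEE, Matrix.one_mul, Matrix.diagonal_mul_diagonal]
        congr 6
        funext i
        rw [← (hw i).2, sq (a i), mul_div_assoc]
      -- The scalar ratios have produced U Λ U' = T; the outer square roots now undo the
      -- normalization of `R`.
      _ = d.frame * ((d.sqrt * d.invSqrt) * (d.frameᵀ * (R * (d.frame *
          ((d.invSqrt * d.sqrt) * d.frameᵀ))))) := by
        rw [← normalized_eq]
        simp only [Matrix.mul_assoc]
      _ = d.frame * d.frameᵀ * R * (d.frame * d.frameᵀ) := by
        rw [sqrt_mul_invSqrt, invSqrt_mul_sqrt, Matrix.one_mul, Matrix.one_mul]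
        simp only [Matrix.mul_assoc]
      _ = R := d.frame_mul_transpose_mul hR hDR

end SpectralData

/-- A diagonalization with the non-zero eigenvalues in front. -/
lemma exists_sorted_diagonalization {m : ℕ} {D : Matrix (Fin m) (Fin m) ℝ} (hD : D.PosSemidef) :
    ∃ (V : Matrix (Fin m) (Fin m) ℝ) (l : Fin D.rank → ℝ),
      V ∈ Matrix.orthogonalGroup (Fin m) ℝ ∧ (∀ i, 0 < l i) ∧
      D = V * (colEmb m D.rank * Matrix.diagonal l * (colEmb m D.rank)ᵀ) * Vᵀ := by
  classical
  have hH := hD.isHermitian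
  have hle : D.rank ≤ m := D.rank_le_width
  -- The rank counts the non-zero eigenvalues, so a bijection from the first `D.rank` indices to
  -- theirs extends to a permutation `σ` that moves them to the front.
  have hcard : Fintype.card {i : Fin m // (i : ℕ) < D.rank} =
      Fintype.card {i // hH.eigenvalues i ≠ 0} := by
    rw [← hH.rank_eq_card_non_zero_eigs, Fintype.card_subtype]
    simp [Fin.card_filter_val_lt, hle]
  let σ : Equiv.Perm (Fin m) := (Fintype.equivOfCardEq hcard).extendSubtype
  have hσ : ∀ i : Fin m, (i : ℕ) < D.rank → hH.eigenvalues (σ i) ≠ 0 := fun i hi =>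
    Equiv.extendSubtype_mem (Fintype.equivOfCardEq hcard) i hi
  have hσ' : ∀ i : Fin m, ¬ (i : ℕ) < D.rank → hH.eigenvalues (σ i) = 0 := fun i hi =>
    not_not.1 (Equiv.extendSubtype_not_mem (Fintype.equivOfCardEq hcard) i hi)
  let W : Matrix (Fin m) (Fin m) ℝ := hH.eigenvectorUnitary
  have hW : Wᵀ * W = 1 :=
    (Matrix.mem_orthogonalGroup_iff' _ _).1 hH.eigenvectorUnitary.2
  have hspec : D = W * Matrix.diagonal hH.eigenvalues * Wᵀ := by
    conv_lhs => rw [hH.spectral_theorem, Unitary.conjStarAlgAut_apply]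
    rfl
  refine ⟨W.submatrix id σ, fun i => hH.eigenvalues (σ (Fin.castLE hle i)), ?_, ?_, ?_⟩
  · rw [Matrix.mem_orthogonalGroup_iff', Matrix.transpose_submatrix,
      ← Matrix.submatrix_mul _ _ _ _ _ Function.bijective_id, hW, Matrix.submatrix_one_equiv]
  · exact fun i => (hD.eigenvalues_nonneg _).lt_of_ne' (hσ _ i.2)
  · have hdiag : colEmb m D.rank * Matrix.diagonal (fun i => hH.eigenvalues (σ (Fin.castLE hle i))) *
        (colEmb m D.rank)ᵀ = (Matrix.diagonal hH.eigenvalues).submatrix σ σ := by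
      ext i j
      rw [Matrix.mul_apply]
      simp only [Matrix.mul_diagonal, Matrix.transpose_apply, Matrix.submatrix_apply]
      by_cases hi : (i : ℕ) < D.rank
      · rw [Finset.sum_eq_single ⟨i, hi⟩]
        · by_cases hij : i = j
          · subst hij
            simp [colEmb]
          · have : (j : ℕ) ≠ i := fun h => hij (Fin.ext h.symm)
            simp [colEmb, this, hij]
        · intro l _ hl
          have : (i : ℕ) ≠ l := fun h => hl (Fin.ext h.symm)
          simp [colEmb, this]
        · simp
      · rw [Finset.sum_eq_zero]
        · by_cases hij : i = j
          · subst hij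
            simp [hσ' i hi]
          · simp [hij]
        · intro l _
          have : (i : ℕ) ≠ l := fun h => hi (h ▸ l.2)
          simp [colEmb, this]
    rw [hdiag, Matrix.transpose_submatrix, Matrix.submatrix_mul_equiv, Matrix.submatrix_mul_equiv,
      ← hspec, Matrix.submatrix_id_id]

lemma nonempty_spectralData {m : ℕ} {D R : Matrix (Fin m) (Fin m) ℝ} (hD : D.PosSemidef)
    (hR : R.PosSemidef) : Nonempty (SpectralData D R) := by
  obtain ⟨V, l, hV, hl, hDV⟩ := exists_sorted_diagonalization hD
  let N : Matrix (Fin D.rank) (Fin D.rank) ℝ := Matrix.diagonal fun i => (Real.sqrt (l i))⁻¹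
  -- The normalized matrix is a congruence of `R`, so the spectral theorem applies to it.
  have hT : (N * (colEmb m D.rank)ᵀ * Vᵀ * R * V * (colEmb m D.rank * N)).IsHermitian := by
    have := hR.conjTranspose_mul_mul_same (V * (colEmb m D.rank * N))
    convert this.isHermitian using 1
    simp [N, Matrix.conjTranspose_eq_transpose_of_trivial, Matrix.transpose_mul, Matrix.mul_assoc]
  refine ⟨⟨D.rank, rfl, V, l, hT.eigenvectorUnitary, hT.eigenvalues, hV, hl, hDV,
    hT.eigenvectorUnitary.2, ?_⟩⟩
  conv_lhs => rw [hT.spectral_theorem, Unitary.conjStarAlgAut_apply]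
  rfl

/-! ### The closed loop and its control-free part -/

namespace ClosedLoop

variable {m r : ℕ} {P : Plant m r} {κ : ℕ} {η : SignalingRule m} {γ : ControlPolicy m r}
  {Ω : Type u} {M : MeasurableSpace Ω} [mΩ : MeasurableSpace Ω] {μ : Measure Ω}
  (c : ClosedLoop P κ η γ μ)

/-- The signal that would be observed without control. -/
def freeSignal (k : ℕ) (ω : Ω) : Vec m :=
  ∑ j ∈ Finset.range (k + 1), matVec (η.gain k j)ᵀ (c.free j ω) + c.v k ω

/-- The independent Gaussian vectors that drive the system. -/
abbrev sources : Unit ⊕ (Fin κ ⊕ Fin κ) → Ω → Vec m :=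
  Sum.elim (fun _ => c.x 0) (Sum.elim (fun k => c.w k) (fun k => c.v k))

/-- The σ-algebra `M` is arbitrary here and below. It serves to record which sources or signals a
quantity depends on. -/
lemma measurable_free (h0 : Measurable[M] (c.x 0)) {k : ℕ} (hw : ∀ j < k, Measurable[M] (c.w j)) :
    Measurable[M] (c.free k) := by
  induction k with
  | zero => exact h0
  | succ k ih =>
    exact ((measurable_matVec P.A).comp (ih fun j hj => hw j (hj.trans k.lt_succ_self))).add
      (hw k k.lt_succ_self)

lemma measurable_freeSignal (h0 : Measurable[M] (c.x 0)) {k : ℕ}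
    (hw : ∀ j < k, Measurable[M] (c.w j)) (hv : Measurable[M] (c.v k)) :
    Measurable[M] (c.freeSignal k) := by
  refine Measurable.add (Finset.measurable_sum _ fun j hj => ?_) hv
  exact (measurable_matVec _).comp (c.measurable_free h0 fun i hi =>
    hw i (hi.trans_le (Nat.lt_succ_iff.1 (Finset.mem_range.1 hj))))

/-! #### Measurability of the signals -/

/-- A finite family that is almost everywhere measurable has a measurable version. -/
lemma _root_.exists_measurable_tuple {n a : ℕ} {f : ℕ → Ω → Vec a}
    (h : ∀ j ≤ n, AEStronglyMeasurable[M] (f j) μ) :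
    ∃ g : Ω → Fin (n + 1) → Vec a, Measurable[M] g ∧
      (fun ω (j : Fin (n + 1)) => f j ω) =ᵐ[μ] g := by
  have h' : ∀ j : Fin (n + 1), AEStronglyMeasurable[M] (f j) μ :=
    fun j => h j (Nat.lt_succ_iff.1 j.2)
  refine ⟨fun ω j => (h' j).mk _ ω,
    @measurable_pi_lambda _ _ _ M _ _ fun j => (h' j).stronglyMeasurable_mk.measurable, ?_⟩
  have := ae_all_iff.2 fun j => (h' j).ae_eq_mk
  filter_upwards [this] with ω hω
  exact funext hω

lemma aestronglyMeasurable_control {n : ℕ} (hn : n < κ)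
    (h : ∀ j ≤ n, AEStronglyMeasurable[M] (c.s j) μ) : AEStronglyMeasurable[M] (c.u n) μ := by
  obtain ⟨g, hg, hsg⟩ := exists_measurable_tuple h
  refine ⟨fun ω => γ.act n (g ω), ((γ.measurable_act n).comp hg).stronglyMeasurable, ?_⟩
  filter_upwards [c.control_eq n hn, hsg] with ω h1 h2
  rw [h1, ← h2]

/-- The effect of the past controls on the state is a function of the past signals. -/
lemma aestronglyMeasurable_sub_free {n : ℕ} (hn : n ≤ κ)
    (h : ∀ j < n, AEStronglyMeasurable[M] (c.s j) μ) {k : ℕ} (hk : k ≤ n) :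
    AEStronglyMeasurable[M] (fun ω => c.x k ω - c.free k ω) μ := by
  induction k with
  | zero =>
    have : (fun ω => c.x 0 ω - c.free 0 ω) = fun _ => 0 := funext fun ω => sub_self _
    rw [this]
    exact stronglyMeasurable_const.aestronglyMeasurable
  | succ k ih =>
    have h1 := (continuous_matVec P.A).comp_aestronglyMeasurable (ih (Nat.le_of_succ_le hk))
    have h2 := (continuous_matVec P.B).comp_aestronglyMeasurable
      (c.aestronglyMeasurable_control (n := k) (by omega) fun j hj => h j (by omega))
    refine (h1.add h2).congr ?_
    -- The noise `w k` cancels in the difference of the two recursions, leaving A(x_k - x_k^o) + B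
    -- u_k.
    filter_upwards [c.state_eq k (by omega)] with ω hω
    simp only [Pi.add_apply, hω, free, matVec_sub]
    abel

/-- The system is triangular: the correction at stage `k` involves controls before `k` only, hence
signals before `k` only. It can therefore be solved in both directions. -/
lemma signal_ae_eq {k : ℕ} (hk : k < κ) :
    c.s k =ᵐ[μ] fun ω => c.freeSignal k ω +
      ∑ j ∈ Finset.range (k + 1), matVec (η.gain k j)ᵀ (c.x j ω - c.free j ω) := by
  filter_upwards [c.signal_eq k hk] with ω hω
  simp only [hω, freeSignal, matVec_sub, Finset.sum_sub_distrib]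
  abel

lemma aestronglyMeasurable_correction {n : ℕ} (hn : n ≤ κ)
    (h : ∀ j < n, AEStronglyMeasurable[M] (c.s j) μ) {k : ℕ} (hk : k ≤ n) :
    AEStronglyMeasurable[M] (fun ω => ∑ j ∈ Finset.range (k + 1),
      matVec (η.gain k j)ᵀ (c.x j ω - c.free j ω)) μ := by
  rw [← Finset.sum_fn]
  refine Finset.sum_induction _ (fun f => AEStronglyMeasurable[M] f μ) (fun _ _ h h' => h.add h')
    stronglyMeasurable_const.aestronglyMeasurable fun j hj => ?_
  exact (continuous_matVec _).comp_aestronglyMeasurable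
    (c.aestronglyMeasurable_sub_free hn h (k := j)
      ((Nat.lt_succ_iff.1 (Finset.mem_range.1 hj)).trans hk))

/-- The signals are functions of the control-free signals. -/
lemma aestronglyMeasurable_signal {n : ℕ} (hn : n < κ)
    (h : ∀ j ≤ n, AEStronglyMeasurable[M] (c.freeSignal j) μ) {k : ℕ} (hk : k ≤ n) :
    AEStronglyMeasurable[M] (c.s k) μ := by
  induction k using Nat.strong_induction_on with
  | _ k ih =>
    -- With `n := k` the correction asks for the signals with index strictly below `k`, which the
    -- induction hypothesis supplies.
    refine ((h k hk).add (c.aestronglyMeasurable_correction (n := k) (by omega)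
      (fun j hj => ih j hj (by omega)) le_rfl)).congr ?_
    exact (c.signal_ae_eq (by omega)).symm

lemma measurable_signals {n : ℕ} (hn : n < κ) :
    Measurable fun ω (j : Fin (n + 1)) => c.s j ω :=
  measurable_pi_lambda _ fun j => c.measurable_s j (by omega)

lemma signalAlgebra_le {n : ℕ} (hn : n < κ) : c.signalAlgebra n ≤ mΩ :=
  (c.measurable_signals hn).comap_le

lemma measurable_signal_signalAlgebra {n j : ℕ} (hj : j ≤ n) :
    Measurable[c.signalAlgebra n] (c.s j) :=
  (measurable_pi_apply (⟨j, Nat.lt_succ_iff.2 hj⟩ : Fin (n + 1))).comp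
    (comap_measurable fun ω (j : Fin (n + 1)) => c.s j ω)

lemma signalAlgebra_mono {n : ℕ} : c.signalAlgebra n ≤ c.signalAlgebra (n + 1) := by
  have : Measurable[c.signalAlgebra (n + 1)] fun ω (j : Fin (n + 1)) => c.s j ω :=
    @measurable_pi_lambda _ _ _ (c.signalAlgebra (n + 1)) _ _ fun j =>
      c.measurable_signal_signalAlgebra ((Nat.lt_succ_iff.1 j.2).trans n.le_succ)
  exact this.comap_le

/-- The control-free signals are functions of the signals. -/
lemma aestronglyMeasurable_freeSignal {n k : ℕ} (hn : n < κ) (hk : k ≤ n) :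
    AEStronglyMeasurable[c.signalAlgebra n] (c.freeSignal k) μ := by
  have hs : ∀ j ≤ n, AEStronglyMeasurable[c.signalAlgebra n] (c.s j) μ := fun j hj =>
    (c.measurable_signal_signalAlgebra hj).stronglyMeasurable.aestronglyMeasurable
  refine ((hs k hk).sub (c.aestronglyMeasurable_correction hn.le
    (fun j hj => hs j hj.le) hk)).congr ?_
  filter_upwards [c.signal_ae_eq (hk.trans_lt hn)] with ω hω
  simp only [Pi.sub_apply, hω, add_sub_cancel_right]

/-- The signals have an `M`-measurable version, and independence survives modification on a null
set. `M` will be generated by the sources other than `w n`, and later by the control-free signals.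
-/
lemma indepFun_signals {n : ℕ} (hn : n < κ) {X : Ω → Vec m}
    (hX : Indep (MeasurableSpace.comap X inferInstance) M μ)
    (h : ∀ j ≤ n, AEStronglyMeasurable[M] (c.freeSignal j) μ) :
    IndepFun X (fun ω (j : Fin (n + 1)) => c.s j ω) μ := by
  obtain ⟨g, hg, hsg⟩ := exists_measurable_tuple fun j hj =>
    c.aestronglyMeasurable_signal hn h hj
  refine IndepFun.congr ?_ (ae_eq_refl X) hsg.symm
  rw [IndepFun_iff_Indep]
  exact indep_of_indep_of_le_right hX hg.comap_le

/-! #### Second moments of the control-free quantities -/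

lemma hasGaussianLaw_sources (i : Unit ⊕ (Fin κ ⊕ Fin κ)) : HasGaussianLaw (c.sources i) μ := by
  rcases i with _ | k | k
  · exact c.init_law.hasGaussianLaw
  · exact (c.w_law k k.2).hasGaussianLaw
  · exact (c.v_law k k.2).hasGaussianLaw

lemma measurable_sources (i : Unit ⊕ (Fin κ ⊕ Fin κ)) : Measurable (c.sources i) := by
  rcases i with _ | k | k
  · exact c.measurable_init
  · exact c.measurable_w k k.2
  · exact c.measurable_v k k.2

lemma memLp_sources (i : Unit ⊕ (Fin κ ⊕ Fin κ)) : MemLp (c.sources i) 2 μ :=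
  (c.hasGaussianLaw_sources i).memLp_two

lemma memLp_w {k : ℕ} (hk : k < κ) : MemLp (c.w k) 2 μ := c.memLp_sources (.inr (.inl ⟨k, hk⟩))

lemma memLp_v {k : ℕ} (hk : k < κ) : MemLp (c.v k) 2 μ := c.memLp_sources (.inr (.inr ⟨k, hk⟩))

lemma memLp_free {k : ℕ} (hk : k ≤ κ) : MemLp (c.free k) 2 μ := by
  induction k with
  | zero => exact c.memLp_sources (.inl ())
  | succ k ih => exact ((ih (Nat.le_of_succ_le hk)).matVec P.A).add (c.memLp_w hk)

lemma memLp_freeSignal {k : ℕ} (hk : k < κ) : MemLp (c.freeSignal k) 2 μ :=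
  (memLp_finsetSum _ fun j hj => (c.memLp_free (by
    have := Finset.mem_range.1 hj
    omega)).matVec _).add (c.memLp_v hk)

lemma crossCov_sources {i j : Unit ⊕ (Fin κ ⊕ Fin κ)} (hij : i ≠ j) :
    crossCov μ (c.sources i) (c.sources j) = 0 :=
  (c.indep.indepFun hij).crossCov_eq_zero (c.memLp_sources i) (c.memLp_sources j)

/-- The noise that drives the next state is independent of the signals received so far. -/
lemma indepFun_w_signals {n : ℕ} (hn : n < κ) :
    IndepFun (c.w n) (fun ω (j : Fin (n + 1)) => c.s j ω) μ := by
  let e : Unit ⊕ (Fin κ ⊕ Fin κ) := .inr (.inl ⟨n, hn⟩)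
  let F : Unit ⊕ (Fin κ ⊕ Fin κ) → MeasurableSpace Ω := fun i =>
    MeasurableSpace.comap (c.sources i) inferInstance
  have hind : Indep (⨆ i ∈ ({e} : Set _), F i) (⨆ i ∈ ({e}ᶜ : Set _), F i) μ :=
    indep_iSup_of_disjoint (fun i => (c.measurable_sources i).comap_le) c.indep
      disjoint_compl_right
  have hmeas : ∀ i, i ≠ e → Measurable[⨆ i ∈ ({e}ᶜ : Set _), F i] (c.sources i) := fun i hi =>
    measurable_iff_comap_le.2 (le_iSup₂ (f := fun i (_ : i ∈ ({e}ᶜ : Set _)) => F i) i hi)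
  rw [iSup_singleton] at hind
  refine c.indepFun_signals hn hind fun j hj => ?_
  refine (c.measurable_freeSignal (k := j) (hmeas (.inl ()) (by simp [e])) (fun i hi => ?_)
    (hmeas (.inr (.inr ⟨j, by omega⟩)) (by simp [e]))).stronglyMeasurable.aestronglyMeasurable
  -- Control-free signals up to index `n` involve only `w i` with i < j ≤ n, so never `w n`.
  refine hmeas (.inr (.inl ⟨i, by omega⟩)) ?_
  simp only [e, ne_eq, Sum.inr.injEq, Sum.inl.injEq, Fin.mk.injEq]
  omega

variable [IsProbabilityMeasure μ]

lemma condExp_signalAlgebra_of_indepFun {n : ℕ} (hn : n < κ) {X : Ω → Vec m} (hX : Measurable X)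
    (h : IndepFun X (fun ω (j : Fin (n + 1)) => c.s j ω) μ) (h0 : ∫ ω, X ω ∂μ = 0) :
    μ[X | c.signalAlgebra n] =ᵐ[μ] 0 := by
  have := condExp_indep_eq hX.comap_le (c.signalAlgebra_le hn)
    (comap_measurable X).stronglyMeasurable ((IndepFun_iff_Indep _ _ _).1 h)
  rw [h0] at this
  exact this

lemma integral_free {k : ℕ} (hk : k ≤ κ) : ∫ ω, c.free k ω ∂μ = 0 := by
  induction k with
  | zero => exact integral_eq_zero_of_hasLaw c.init_law
  | succ k ih =>
    have hf := c.memLp_free (Nat.le_of_succ_le hk)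
    have : ∫ ω, (matVec P.A (c.free k ω) + c.w k ω) ∂μ = 0 := by
      rw [integral_add ((hf.matVec P.A).integrable one_le_two)
        ((c.memLp_w hk).integrable one_le_two), integral_matVec hf, ih (Nat.le_of_succ_le hk),
        integral_eq_zero_of_hasLaw (c.w_law k hk), add_zero]
      exact map_zero (matVecCLM P.A)
    exact this

/-- The state x_k^o is built from the initial state and the noises `w j` with `j < k` alone. -/
lemma crossCov_free_sources {k : ℕ} (hk : k ≤ κ) {i : Unit ⊕ (Fin κ ⊕ Fin κ)} (h0 : .inl () ≠ i)
    (hw : ∀ j : Fin κ, (j : ℕ) < k → .inr (.inl j) ≠ i) :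
    crossCov μ (c.free k) (c.sources i) = 0 := by
  induction k with
  | zero => exact c.crossCov_sources h0
  | succ k ih =>
    have hf := c.memLp_free (Nat.le_of_succ_le hk)
    have h1 : crossCov μ (c.w k) (c.sources i) = 0 :=
      c.crossCov_sources (hw ⟨k, hk⟩ k.lt_succ_self)
    have h2 := ih (Nat.le_of_succ_le hk) fun j hj => hw j (hj.trans k.lt_succ_self)
    refine (crossCov_add_left (hf.matVec P.A) (c.memLp_w hk) (c.memLp_sources i)).trans ?_
    rw [crossCov_matVec_left hf (c.memLp_sources i), h1, h2, Matrix.mul_zero, add_zero]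

lemma crossCov_free_w {j k : ℕ} (hjk : j ≤ k) (hk : k < κ) :
    crossCov μ (c.free j) (c.w k) = 0 :=
  c.crossCov_free_sources (i := .inr (.inl ⟨k, hk⟩)) (by omega) (by simp) fun l hl => by
    simp only [ne_eq, Sum.inr.injEq, Sum.inl.injEq, Fin.ext_iff]
    omega

lemma crossCov_free_v {j k : ℕ} (hj : j ≤ κ) (hk : k < κ) :
    crossCov μ (c.free j) (c.v k) = 0 :=
  c.crossCov_free_sources (i := .inr (.inr ⟨k, hk⟩)) hj (by simp) fun l hl => by simp

lemma covMatrix_free {k : ℕ} (hk : k ≤ κ) : covMatrix μ (c.free k) = P.freeCov k := by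
  induction k with
  | zero => exact covMatrix_of_hasLaw P.initCov_psd c.init_law
  | succ k ih =>
    have hf := c.memLp_free (Nat.le_of_succ_le hk)
    refine (covMatrix_add (hf.matVec P.A) (c.memLp_w hk) ?_).trans ?_
    · rw [crossCov_matVec_left hf (c.memLp_w hk), c.crossCov_free_w le_rfl hk, Matrix.mul_zero]
    · rw [covMatrix_matVec hf, ih (Nat.le_of_succ_le hk),
        covMatrix_of_hasLaw P.stepCov_psd (c.w_law k hk)]
      rfl

/-! #### Necessity of the linear matrix inequalities -/

/-- The centered noise `w n` is independent of the signals up to `n` and drops out, while `P.A`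
passes through the conditional mean. This is the source of the term A H A' in the inequalities. -/
lemma covMatrix_prediction {n : ℕ} (hn : n < κ) :
    covMatrix μ (μ[c.free (n + 1) | c.signalAlgebra n]) = P.A * c.posteriorCov n * P.Aᵀ := by
  have hf := c.memLp_free hn.le
  have h0 := c.condExp_signalAlgebra_of_indepFun hn (c.measurable_w n hn)
    (c.indepFun_w_signals hn) (integral_eq_zero_of_hasLaw (c.w_law n hn))
  have h1 := condExp_add ((hf.matVec P.A).integrable one_le_two)
    ((c.memLp_w hn).integrable one_le_two) (c.signalAlgebra n)
  have h2 := (matVecCLM P.A).comp_condExp_comm (m := c.signalAlgebra n)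
    (hf.integrable one_le_two)
  have h : μ[c.free (n + 1) | c.signalAlgebra n] =ᵐ[μ]
      fun ω => matVec P.A ((μ[c.free n | c.signalAlgebra n]) ω) := by
    refine Filter.EventuallyEq.trans h1 ?_
    filter_upwards [h0, h2] with ω e0 e2
    rw [Pi.add_apply, e0, Pi.zero_apply, add_zero]
    exact e2.symm
  rw [covMatrix_congr h, covMatrix_matVec (hf.condExp one_le_two)]
  rfl

/-- The covariances of the posterior means satisfy the linear matrix inequalities. -/
theorem satisfiesLMI_posteriorCov : P.SatisfiesLMI κ c.posteriorCov := by
  have hub : ∀ k, k < κ → (P.freeCov k - c.posteriorCov k).PosSemidef := fun k hk => by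
    rw [← c.covMatrix_free hk.le]
    exact posSemidef_covMatrix_sub_condExp (c.signalAlgebra_le hk) (c.memLp_free hk.le)
  refine ⟨fun h => ⟨hub 0 h, ?_⟩, fun k hk => ⟨hub _ hk, ?_⟩⟩
  · exact posSemidef_covMatrix ((c.memLp_free h.le).condExp one_le_two)
  -- Both terms become covariances of conditional means of the same vector, given increasing
  -- σ-algebras.
  · rw [← c.covMatrix_prediction (Nat.lt_of_succ_lt hk)]
    exact posSemidef_covMatrix_condExp_sub_condExp c.signalAlgebra_mono (c.signalAlgebra_le hk)
      (c.memLp_free hk.le)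

end ClosedLoop

/-! ### Filtering for memoryless rules -/

namespace ClosedLoop

variable {m r : ℕ} {P : Plant m r} {κ : ℕ} {η : SignalingRule m} {γ : ControlPolicy m r}
  {Ω : Type u} [MeasurableSpace Ω] {μ : Measure Ω} (c : ClosedLoop P κ η γ μ)

/-- A linear combination of the first `n` control-free signals. -/
def linEst (C : ℕ → Matrix (Fin m) (Fin m) ℝ) (n : ℕ) (ω : Ω) : Vec m :=
  ∑ j ∈ Finset.range n, matVec (C j) (c.freeSignal j ω)

lemma freeSignal_eq_of_isMemoryless (hη : η.IsMemoryless κ) {k : ℕ} (hk : k < κ) :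
    c.freeSignal k = fun ω => matVec (η.gain k k)ᵀ (c.free k ω) + c.v k ω := by
  funext ω
  rw [freeSignal, Finset.sum_range_succ, Finset.sum_eq_zero, zero_add]
  intro j hj
  rw [hη k hk j (Finset.mem_range.1 hj), Matrix.transpose_zero, matVec_zero_left]

/-- `X` is a linear function of the sources. -/
def IsLinear (X : Ω → Vec m) : Prop :=
  ∃ L : (Unit ⊕ (Fin κ ⊕ Fin κ) → Vec m) →L[ℝ] Vec m, ∀ ω, X ω = L fun i => c.sources i ω

namespace IsLinear

variable {c}

lemma source (i : Unit ⊕ (Fin κ ⊕ Fin κ)) : c.IsLinear (c.sources i) :=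
  ⟨ContinuousLinearMap.proj i, fun _ => rfl⟩

lemma add {X Y : Ω → Vec m} (hX : c.IsLinear X) (hY : c.IsLinear Y) :
    c.IsLinear fun ω => X ω + Y ω := by
  obtain ⟨L, hL⟩ := hX
  obtain ⟨L', hL'⟩ := hY
  exact ⟨L + L', fun ω => congrArg₂ (· + ·) (hL ω) (hL' ω)⟩

lemma sub {X Y : Ω → Vec m} (hX : c.IsLinear X) (hY : c.IsLinear Y) :
    c.IsLinear fun ω => X ω - Y ω := by
  obtain ⟨L, hL⟩ := hX
  obtain ⟨L', hL'⟩ := hY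
  exact ⟨L - L', fun ω => congrArg₂ (· - ·) (hL ω) (hL' ω)⟩

lemma matVec {X : Ω → Vec m} (hX : c.IsLinear X) (N : Matrix (Fin m) (Fin m) ℝ) :
    c.IsLinear fun ω => matVec N (X ω) := by
  obtain ⟨L, hL⟩ := hX
  exact ⟨(matVecCLM N).comp L, fun ω => congrArg (matVecCLM N) (hL ω)⟩

lemma sum {ι : Type*} (s : Finset ι) {X : ι → Ω → Vec m} (hX : ∀ i ∈ s, c.IsLinear (X i)) :
    c.IsLinear fun ω => ∑ i ∈ s, X i ω := by
  rw [← Finset.sum_fn]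
  exact Finset.sum_induction _ c.IsLinear (fun _ _ h h' => h.add h') ⟨0, fun _ => rfl⟩ hX

end IsLinear

lemma isLinear_free {k : ℕ} (hk : k ≤ κ) : c.IsLinear (c.free k) := by
  induction k with
  | zero => exact .source (.inl ())
  | succ k ih =>
    exact ((ih (Nat.le_of_succ_le hk)).matVec P.A).add (.source (.inr (.inl ⟨k, hk⟩)))

lemma isLinear_freeSignal {k : ℕ} (hk : k < κ) : c.IsLinear (c.freeSignal k) :=
  (IsLinear.sum _ fun j hj => (c.isLinear_free (by
    have := Finset.mem_range.1 hj
    omega)).matVec _).add (.source (.inr (.inr ⟨k, hk⟩)))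

lemma isLinear_linEst (C : ℕ → Matrix (Fin m) (Fin m) ℝ) {n : ℕ} (hn : n ≤ κ) :
    c.IsLinear (c.linEst C n) :=
  IsLinear.sum _ fun _ hj =>
    (c.isLinear_freeSignal ((Finset.mem_range.1 hj).trans_le hn)).matVec _

lemma hasGaussianLaw_tuple : HasGaussianLaw (fun ω i => c.sources i ω) μ :=
  c.indep.hasGaussianLaw c.hasGaussianLaw_sources

lemma memLp_linEst (C : ℕ → Matrix (Fin m) (Fin m) ℝ) {n : ℕ} (hn : n ≤ κ) :
    MemLp (c.linEst C n) 2 μ :=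
  memLp_finsetSum _ fun _ hj =>
    (c.memLp_freeSignal ((Finset.mem_range.1 hj).trans_le hn)).matVec _

lemma IsLinear.integral_eq_zero {X : Ω → Vec m} (hX : c.IsLinear X) : ∫ ω, X ω ∂μ = 0 := by
  obtain ⟨L, hL⟩ := hX
  have hint := c.hasGaussianLaw_tuple.integrable
  have h0 : ∫ ω, (fun i => c.sources i ω) ∂μ = 0 := by
    funext i
    have := (ContinuousLinearMap.proj (R := ℝ) (φ := fun _ => Vec m) i).integral_comp_comm hint
    refine this.symm.trans ?_
    rcases i with _ | k | k
    · exact integral_eq_zero_of_hasLaw c.init_law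
    · exact integral_eq_zero_of_hasLaw (c.w_law k k.2)
    · exact integral_eq_zero_of_hasLaw (c.v_law k k.2)
  simp only [hL]
  rw [L.integral_comp_comm hint, h0, map_zero]

variable [IsProbabilityMeasure μ]

lemma crossCov_linEst {X : Ω → Vec m} (hX : MemLp X 2 μ) (C : ℕ → Matrix (Fin m) (Fin m) ℝ)
    {n : ℕ} (hn : n ≤ κ) (h : ∀ j < n, crossCov μ X (c.freeSignal j) = 0) :
    crossCov μ X (c.linEst C n) = 0 := by
  have hs : ∀ j ∈ Finset.range n, MemLp (c.freeSignal j) 2 μ := fun j hj =>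
    c.memLp_freeSignal ((Finset.mem_range.1 hj).trans_le hn)
  refine (crossCov_sum_right _ hX fun j hj => (hs j hj).matVec _).trans ?_
  refine Finset.sum_eq_zero fun j hj => ?_
  rw [crossCov_matVec_right hX (hs j hj), h j (Finset.mem_range.1 hj), Matrix.zero_mul]

lemma crossCov_freeSignal_left {X : Ω → Vec m} (hX : MemLp X 2 μ) (hη : η.IsMemoryless κ) {k : ℕ}
    (hk : k < κ) (hf : crossCov μ (c.free k) X = 0) (hv : crossCov μ (c.v k) X = 0) :
    crossCov μ (c.freeSignal k) X = 0 := by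
  rw [c.freeSignal_eq_of_isMemoryless hη hk,
    crossCov_add_left ((c.memLp_free hk.le).matVec _) (c.memLp_v hk) hX,
    crossCov_matVec_left (c.memLp_free hk.le) hX, hf, hv, Matrix.mul_zero, add_zero]

lemma crossCov_v_freeSignal (hη : η.IsMemoryless κ) {j k : ℕ} (hjk : j < k) (hk : k < κ) :
    crossCov μ (c.v k) (c.freeSignal j) = 0 := by
  have hj := hjk.trans hk
  have hne : (.inr (.inr ⟨j, hj⟩) : Unit ⊕ (Fin κ ⊕ Fin κ)) ≠ .inr (.inr ⟨k, hk⟩) := by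
    simpa using hjk.ne
  rw [← crossCov_transpose, c.crossCov_freeSignal_left (c.memLp_v hk) hη hj
    (c.crossCov_free_v hj.le hk) (c.crossCov_sources hne), Matrix.transpose_zero]

lemma crossCov_w_freeSignal (hη : η.IsMemoryless κ) {j k : ℕ} (hjk : j ≤ k) (hk : k < κ) :
    crossCov μ (c.w k) (c.freeSignal j) = 0 := by
  have hj := hjk.trans_lt hk
  have hne : (.inr (.inr ⟨j, hj⟩) : Unit ⊕ (Fin κ ⊕ Fin κ)) ≠ .inr (.inl ⟨k, hk⟩) := by simp
  rw [← crossCov_transpose, c.crossCov_freeSignal_left (c.memLp_w hk) hη hj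
    (c.crossCov_free_w hjk hk) (c.crossCov_sources hne), Matrix.transpose_zero]

/-- The combination with coefficients `C` of the first `n` signals is the best linear estimate of
the state with index `k`, and has covariance `S`. -/
def IsBestEstimate (C : ℕ → Matrix (Fin m) (Fin m) ℝ) (n k : ℕ) (S : Matrix (Fin m) (Fin m) ℝ) :
    Prop :=
  (∀ j < n, crossCov μ (fun ω => c.free k ω - c.linEst C n ω) (c.freeSignal j) = 0) ∧
    covMatrix μ (c.linEst C n) = S

/-- Prediction step. -/
lemma IsBestEstimate.predict (hη : η.IsMemoryless κ) {C : ℕ → Matrix (Fin m) (Fin m) ℝ} {k : ℕ}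
    (hk : k + 1 < κ) {S : Matrix (Fin m) (Fin m) ℝ} (h : c.IsBestEstimate C (k + 1) k S) :
    c.IsBestEstimate (fun j => P.A * C j) (k + 1) (k + 1) (P.A * S * P.Aᵀ) := by
  have hk' : k < κ := Nat.lt_of_succ_lt hk
  have hlin : c.linEst (fun j => P.A * C j) (k + 1) =
      fun ω => matVec P.A (c.linEst C (k + 1) ω) := by
    funext ω
    simp only [linEst, matVec_sum, matVec_matVec]
  have hE := c.memLp_linEst C hk'
  have hX := c.memLp_free hk'.le
  refine ⟨fun j hj => ?_, ?_⟩
  · have hres : (fun ω => c.free (k + 1) ω - c.linEst (fun j => P.A * C j) (k + 1) ω) =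
        fun ω => matVec P.A (c.free k ω - c.linEst C (k + 1) ω) + c.w k ω := by
      funext ω
      simp only [hlin, matVec_sub, free]
      abel
    have hs := c.memLp_freeSignal (k := j) (by omega)
    have hd : MemLp (fun ω => c.free k ω - c.linEst C (k + 1) ω) 2 μ := hX.sub hE
    rw [hres, crossCov_add_left (hd.matVec P.A) (c.memLp_w hk') hs, crossCov_matVec_left hd hs,
      h.1 j hj, c.crossCov_w_freeSignal hη (by omega) hk', Matrix.mul_zero, add_zero]
  · rw [hlin, covMatrix_matVec hE, h.2]

/-- Update step: `K` is the gain that is applied to the innovation. -/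
lemma IsBestEstimate.update (hη : η.IsMemoryless κ) {C : ℕ → Matrix (Fin m) (Fin m) ℝ} {k : ℕ}
    (hk : k < κ) {S₀ D R K : Matrix (Fin m) (Fin m) ℝ} (h : c.IsBestEstimate C k k S₀)
    (hD : P.freeCov k - S₀ = D)
    (hK : K * ((η.gain k k)ᵀ * D * η.gain k k + η.noiseCov k) = D * η.gain k k)
    (hR : K * ((η.gain k k)ᵀ * D * η.gain k k + η.noiseCov k) * Kᵀ = R) :
    ∃ C' : ℕ → Matrix (Fin m) (Fin m) ℝ, c.IsBestEstimate C' (k + 1) k (S₀ + R) := by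
  set L := η.gain k k with hL
  set p := c.linEst C k with hp
  let e : Ω → Vec m := fun ω => c.free k ω - p ω
  -- The innovation: the control-free signal minus its prediction `Lᵀ p`.
  let y : Ω → Vec m := fun ω => matVec Lᵀ (e ω) + c.v k ω
  have mx : MemLp (c.free k) 2 μ := c.memLp_free hk.le
  have mp : MemLp p 2 μ := c.memLp_linEst C hk.le
  have me : MemLp e 2 μ := mx.sub mp
  have mv : MemLp (c.v k) 2 μ := c.memLp_v hk
  have my : MemLp y 2 μ := (me.matVec _).add mv
  have mKy : MemLp (fun ω => matVec K (y ω)) 2 μ := my.matVec K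
  have ms : ∀ j ≤ k, MemLp (c.freeSignal j) 2 μ := fun j hj => c.memLp_freeSignal (hj.trans_lt hk)
  have hep : crossCov μ e p = 0 := c.crossCov_linEst me C hk.le h.1
  have hvs : ∀ j < k, crossCov μ (c.v k) (c.freeSignal j) = 0 := fun j hj =>
    c.crossCov_v_freeSignal hη hj hk
  have hvp : crossCov μ (c.v k) p = 0 := c.crossCov_linEst mv C hk.le hvs
  have hev : crossCov μ e (c.v k) = 0 := by
    rw [crossCov_sub_left mx mp mv, c.crossCov_free_v hk.le hk, ← crossCov_transpose, hvp,
      Matrix.transpose_zero, sub_zero]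
  -- Pythagoras for x_k^o = e + p with `e` and `p` uncorrelated.
  have hcov : covMatrix μ e = D := by
    have hx : c.free k = fun ω => e ω + p ω := funext fun ω => (sub_add_cancel _ _).symm
    have := c.covMatrix_free hk.le
    rw [hx, covMatrix_add me mp hep, h.2] at this
    rw [← hD, ← this, add_sub_cancel_right]
  have hey : crossCov μ e y = D * L := by
    rw [crossCov_add_right (me.matVec _) mv me, crossCov_matVec_right me me, hev, add_zero,
      ← covMatrix_eq_crossCov, hcov, Matrix.transpose_transpose]
  have hyy : covMatrix μ y = Lᵀ * D * L + η.noiseCov k := by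
    rw [covMatrix_add (me.matVec _) mv, covMatrix_matVec me, hcov, Matrix.transpose_transpose,
      covMatrix_of_hasLaw (η.noiseCov_psd k) (c.v_law k hk)]
    rw [crossCov_matVec_left me mv, hev, Matrix.mul_zero]
  have hys : ∀ j < k, crossCov μ y (c.freeSignal j) = 0 := fun j hj => by
    rw [crossCov_add_left (me.matVec _) mv (ms j hj.le), crossCov_matVec_left me (ms j hj.le),
      h.1 j hj, hvs j hj, Matrix.mul_zero, add_zero]
  have hyp : crossCov μ y p = 0 := c.crossCov_linEst my C hk.le hys
  have hsk : c.freeSignal k = fun ω => y ω + matVec Lᵀ (p ω) := by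
    rw [c.freeSignal_eq_of_isMemoryless hη hk]
    funext ω
    simp only [y, e, matVec_sub]
    abel
  -- Coefficients obtained by expanding p + K(s_k - L'p) in the control-free signals.
  let C' : ℕ → Matrix (Fin m) (Fin m) ℝ := fun j => if j < k then C j - K * (Lᵀ * C j) else K
  have hlin : c.linEst C' (k + 1) = fun ω => p ω + matVec K (y ω) := by
    funext ω
    have h1 : ∑ j ∈ Finset.range k, matVec (C' j) (c.freeSignal j ω) =
        p ω - matVec K (matVec Lᵀ (p ω)) := by
      simp only [hp, linEst, matVec_sum, matVec_matVec]
      rw [← Finset.sum_sub_distrib]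
      refine Finset.sum_congr rfl fun j hj => ?_
      rw [← matVec_sub_left]
      simp only [C', if_pos (Finset.mem_range.1 hj)]
    rw [linEst, Finset.sum_range_succ, h1, hsk]
    simp only [C', lt_irrefl, if_false, matVec_add]
    abel
  refine ⟨C', fun j hj => ?_, ?_⟩
  · have hres : (fun ω => c.free k ω - c.linEst C' (k + 1) ω) =
        fun ω => e ω - matVec K (y ω) := by
      funext ω
      simp only [hlin, e]
      abel
    rw [hres]
    rcases Nat.lt_succ_iff_lt_or_eq.1 hj with hj | rfl
    · rw [crossCov_sub_left me mKy (ms j hj.le), crossCov_matVec_left my (ms j hj.le), h.1 j hj,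
        hys j hj, Matrix.mul_zero, sub_zero]
    -- The current signal is y + L'p. The residual is uncorrelated with `y` by the normal equation
    -- `hK`, and with `p` because `e` and `y` are.
    · have mr : MemLp (fun ω => e ω - matVec K (y ω)) 2 μ := me.sub mKy
      rw [hsk, crossCov_add_right my (mp.matVec _) mr, crossCov_matVec_right mr mp,
        crossCov_sub_left me mKy my, crossCov_sub_left me mKy mp, crossCov_matVec_left my my,
        crossCov_matVec_left my mp, hey, ← covMatrix_eq_crossCov, hyy, hK, hep, hyp]
      simp
  · rw [hlin, covMatrix_add mp mKy, h.2, covMatrix_matVec my, hyy, hR]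
    rw [crossCov_matVec_right mp my, ← crossCov_transpose, hyp, Matrix.transpose_zero,
      Matrix.zero_mul]

/-- A linear function of the sources that is uncorrelated with the control-free signals is
independent of them. -/
lemma IsLinear.indepFun {X : Ω → Vec m} (hX : c.IsLinear X) (mX : MemLp X 2 μ) {n : ℕ} (hn : n < κ)
    (h : ∀ j ≤ n, crossCov μ X (c.freeSignal j) = 0) :
    IndepFun X (fun ω (j : Fin (n + 1)) => c.freeSignal j ω) μ := by
  obtain ⟨L, hL⟩ := hX
  have hlt : ∀ j : Fin (n + 1), (j : ℕ) < κ := fun j => by omega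
  choose L' hL' using fun j : Fin (n + 1) => c.isLinear_freeSignal (hlt j)
  -- The pair is a linear image of one Gaussian vector, the tuple of sources; this joint law is what
  -- makes vanishing covariance sufficient for independence.
  have hjoint : HasGaussianLaw
      (fun ω => (X ω, fun (j : Fin (n + 1)) => c.freeSignal j ω)) μ := by
    have := c.hasGaussianLaw_tuple.map_fun (L.prod (ContinuousLinearMap.pi L'))
    refine this.congr (.of_forall fun ω => ?_)
    exact Prod.ext (hL ω).symm (funext fun j => (hL' j ω).symm)
  refine hjoint.indepFun_of_covariance_strongDual fun L₁ L₂ => ?_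
  have hsum : (L₂ ∘ fun ω (j : Fin (n + 1)) => c.freeSignal j ω) = fun ω =>
      ∑ j : Fin (n + 1), (L₂.comp (ContinuousLinearMap.single ℝ (fun _ => Vec m) j))
        (c.freeSignal j ω) := by
    funext ω
    simp only [Function.comp_apply, ContinuousLinearMap.comp_apply]
    rw [← map_sum]
    congr 1
    exact (LinearMap.sum_single_apply _ _).symm
  have hmem : ∀ j : Fin (n + 1), MemLp (fun ω =>
      (L₂.comp (ContinuousLinearMap.single ℝ (fun _ => Vec m) j)) (c.freeSignal j ω)) 2 μ :=
    fun j => ContinuousLinearMap.comp_memLp' _ (c.memLp_freeSignal (hlt j))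
  rw [hsum, covariance_fun_sum_right hmem (L₁.comp_memLp' mX)]
  exact Finset.sum_eq_zero fun j _ => covariance_strongDual_eq_zero mX
    (c.memLp_freeSignal (hlt j)) (h j (by omega)) _ _

/-- The posterior mean is the best linear estimate, whatever the control policy is. -/
lemma IsBestEstimate.posteriorCov_eq {C : ℕ → Matrix (Fin m) (Fin m) ℝ} {k : ℕ} (hk : k < κ)
    {S : Matrix (Fin m) (Fin m) ℝ} (h : c.IsBestEstimate C (k + 1) k S) :
    c.posteriorCov k = S := by
  set p := c.linEst C (k + 1) with hp
  let e : Ω → Vec m := fun ω => c.free k ω - p ω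
  have mx : MemLp (c.free k) 2 μ := c.memLp_free hk.le
  have mp : MemLp p 2 μ := c.memLp_linEst C hk
  have me : MemLp e 2 μ := mx.sub mp
  have le : c.IsLinear e := (c.isLinear_free hk.le).sub (c.isLinear_linEst C hk)
  have hfm : ∀ j < κ, Measurable (c.freeSignal j) := fun j hj =>
    c.measurable_freeSignal c.measurable_init (fun i hi => c.measurable_w i (hi.trans hj))
      (c.measurable_v j hj)
  have hem : Measurable e := by
    refine (c.measurable_free c.measurable_init fun i hi => c.measurable_w i (hi.trans hk)).sub ?_
    exact Finset.measurable_sum _ fun j hj =>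
      (measurable_matVec _).comp (hfm j ((Finset.mem_range.1 hj).trans_le hk))
  have hind := (IndepFun_iff_Indep _ _ _).1
    (le.indepFun c me hk fun j hj => h.1 j (Nat.lt_succ_iff.2 hj))
  -- Independence passes from the control-free signals to the actual ones, which is where the
  -- control policy disappears.
  have hes := c.indepFun_signals hk hind fun j hj => by
    have := (measurable_pi_apply (⟨j, Nat.lt_succ_iff.2 hj⟩ : Fin (k + 1))).comp
      (comap_measurable fun ω (j : Fin (k + 1)) => c.freeSignal j ω)
    exact this.stronglyMeasurable.aestronglyMeasurable
  have he := c.condExp_signalAlgebra_of_indepFun hk hem hes (le.integral_eq_zero c)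
  have hpm : AEStronglyMeasurable[c.signalAlgebra k] p μ := by
    have : p = ∑ j ∈ Finset.range (k + 1), fun ω => matVec (C j) (c.freeSignal j ω) := by
      rw [Finset.sum_fn]
      rfl
    rw [this]
    refine Finset.sum_induction _ (fun f => AEStronglyMeasurable[c.signalAlgebra k] f μ)
      (fun _ _ h h' => h.add h') stronglyMeasurable_const.aestronglyMeasurable fun j hj => ?_
    exact (continuous_matVec _).comp_aestronglyMeasurable
      (c.aestronglyMeasurable_freeSignal hk (Nat.lt_succ_iff.1 (Finset.mem_range.1 hj)))
  have hpc := condExp_of_aestronglyMeasurable' (c.signalAlgebra_le hk) hpm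
    (mp.integrable one_le_two)
  have hx : c.free k = e + p := funext fun ω => (sub_add_cancel _ _).symm
  have hsum := condExp_add (me.integrable one_le_two) (mp.integrable one_le_two)
    (c.signalAlgebra k)
  rw [← hx] at hsum
  -- In x_k^o = e + p the independent centered part `e` averages to zero, and `p` is already a
  -- function of the signals.
  have hfin : μ[c.free k | c.signalAlgebra k] =ᵐ[μ] p := by
    filter_upwards [hsum, he, hpc] with ω h1 h2 h3
    rw [h1, Pi.add_apply, h2, h3, Pi.zero_apply, zero_add]
  rw [posteriorCov, covMatrix_congr hfin, h.2]

end ClosedLoop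

/-! ### The spectral rules -/

namespace Plant.SatisfiesLMI

variable {m r : ℕ} {P : Plant m r} {κ : ℕ} {S : ℕ → Matrix (Fin m) (Fin m) ℝ}

lemma posSemidef_freeCov_sub (h : P.SatisfiesLMI κ S) {k : ℕ} (hk : k < κ) :
    (P.freeCov k - S k).PosSemidef := by
  cases k with
  | zero => exact (h.1 hk).1
  | succ k => exact (h.2 k hk).1

lemma posSemidef_sub_predCov (h : P.SatisfiesLMI κ S) {k : ℕ} (hk : k < κ) :
    (S k - P.predCov S k).PosSemidef := by
  cases k with
  | zero => simpa [predCov] using (h.1 hk).2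
  | succ k => exact (h.2 k hk).2

lemma posSemidef_sub_sub (h : P.SatisfiesLMI κ S) {k : ℕ} (hk : k < κ) :
    (P.freeCov k - P.predCov S k - (S k - P.predCov S k)).PosSemidef := by
  rw [sub_sub_sub_cancel_right]
  exact h.posSemidef_freeCov_sub hk

lemma nonempty_stageData (h : P.SatisfiesLMI κ S) {k : ℕ} (hk : k < κ) :
    Nonempty (StageData P S k) := by
  refine nonempty_spectralData ?_ (h.posSemidef_sub_predCov hk)
  -- Σ_k^o - A S_{k-1} A' is the sum of the two gaps in the inequalities.
  have := (h.posSemidef_freeCov_sub hk).add (h.posSemidef_sub_predCov hk)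
  rwa [sub_add_sub_cancel] at this

lemma lam_mem_Icc (h : P.SatisfiesLMI κ S) {k : ℕ} (hk : k < κ) (d : StageData P S k)
    (i : Fin d.t) : d.lam i ∈ Set.Icc (0 : ℝ) 1 :=
  d.lam_mem_Icc (h.posSemidef_sub_predCov hk) (h.posSemidef_sub_sub hk) i

lemma exists_isSpectralRule (h : P.SatisfiesLMI κ S) :
    ∃ η : SignalingRule m, IsSpectralRule P κ S η := by
  have hex : ∀ k, ∃ G N : Matrix (Fin m) (Fin m) ℝ, N.PosSemidef ∧ (k < κ →
      ∃ (d : StageData P S k) (a b : Fin d.t → ℝ), d.IsWeights a b ∧ G = d.gain a ∧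
        N = d.noise b) := fun k => by
    by_cases hk : k < κ
    · obtain ⟨d⟩ := h.nonempty_stageData hk
      obtain ⟨a, b, hab⟩ := d.exists_isWeights (h.lam_mem_Icc hk d)
      exact ⟨d.gain a, d.noise b, d.posSemidef_noise b, fun _ => ⟨d, a, b, hab, rfl, rfl⟩⟩
    -- Default values beyond the horizon, where no stage data need exist.
    · exact ⟨0, 0, .zero, fun hk' => absurd hk' hk⟩
  choose G N hN hGN using hex
  refine ⟨⟨fun k j => if j = k then G k else 0, N, hN⟩, fun k _ j hj => if_neg hj.ne, ?_⟩
  intro k hk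
  simpa only [if_true] using hGN k hk

end Plant.SatisfiesLMI

namespace IsSpectralRule

variable {m r : ℕ} {P : Plant m r} {κ : ℕ} {η : SignalingRule m} {γ : ControlPolicy m r}
  {S : ℕ → Matrix (Fin m) (Fin m) ℝ} {Ω : Type u} [MeasurableSpace Ω] {μ : Measure Ω}
  [IsProbabilityMeasure μ]

/-- Filter recursion: prediction yields covariance `P.predCov S k`, and the update adds exactly the
missing `S k - P.predCov S k`. -/
lemma exists_isBestEstimate (hη : IsSpectralRule P κ S η) (hS : P.SatisfiesLMI κ S)
    (c : ClosedLoop P κ η γ μ) {k : ℕ} (hk : k < κ) :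
    ∃ C : ℕ → Matrix (Fin m) (Fin m) ℝ, c.IsBestEstimate C (k + 1) k (S k) := by
  have hstep : ∀ {C : ℕ → Matrix (Fin m) (Fin m) ℝ} {k : ℕ}, k < κ →
      c.IsBestEstimate C k k (P.predCov S k) →
      ∃ C' : ℕ → Matrix (Fin m) (Fin m) ℝ, c.IsBestEstimate C' (k + 1) k (S k) := by
    intro C k hk h
    obtain ⟨d, a, b, hw, hg, hn⟩ := hη.2 k hk
    obtain ⟨K, hK, hR⟩ :=
      d.exists_estimator (hS.posSemidef_sub_predCov hk) (hS.posSemidef_sub_sub hk) hw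
    rw [← hg, ← hn] at hK hR
    obtain ⟨C', hC'⟩ := h.update c hη.1 hk rfl hK hR
    rw [add_sub_cancel] at hC'
    exact ⟨C', hC'⟩
  induction k with
  | zero =>
    -- Before any signal the estimate is the empty sum, with covariance `O`, matching the convention
    -- for `predCov` at the first stage.
    refine hstep hk (C := 0) ⟨fun j hj => absurd hj j.not_lt_zero, ?_⟩
    exact crossCov_zero_left _
  | succ k ih =>
    obtain ⟨C, hC⟩ := ih (Nat.lt_of_succ_lt hk)
    exact hstep hk (hC.predict c hη.1 hk)

/-- A spectral rule realizes `S`, whatever the control policy is. -/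
theorem posteriorCov_eq (hη : IsSpectralRule P κ S η) (hS : P.SatisfiesLMI κ S)
    (c : ClosedLoop P κ η γ μ) {k : ℕ} (hk : k < κ) : c.posteriorCov k = S k := by
  obtain ⟨C, hC⟩ := hη.exists_isBestEstimate hS c hk
  exact hC.posteriorCov_eq c hk

end IsSpectralRule

end

theorem proposition1 {m r : ℕ} (P : Plant m r) (κ : ℕ) :
    -- necessity
    (∀ (η : SignalingRule m) (γ : ControlPolicy m r) {Ω : Type u} [MeasurableSpace Ω]
        (μ : Measure Ω) [IsProbabilityMeasure μ] (c : ClosedLoop P κ η γ μ),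
      (∀ k < κ, MemLp (c.free k) 2 μ ∧ secondMoment μ (c.free k) = P.freeCov k) ∧
      P.SatisfiesLMI κ c.posteriorCov) ∧
    -- sufficiency
    (∀ S : ℕ → Matrix (Fin m) (Fin m) ℝ, (∀ k < κ, (S k).PosSemidef) → P.SatisfiesLMI κ S →
      -- eigenvalues of the normalized matrices lie in `[0, 1]`, and weights exist
      (∀ k < κ, ∀ d : StageData P S k,
        (∀ i, d.lam i ∈ Set.Icc (0 : ℝ) 1) ∧ ∃ a b : Fin d.t → ℝ, d.IsWeights a b) ∧
      -- the explicit memoryless rules exist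
      (∃ η : SignalingRule m, IsSpectralRule P κ S η) ∧
      -- each of them realizes `S`, whatever the control policy is
      (∀ η : SignalingRule m, IsSpectralRule P κ S η →
        ∀ (γ : ControlPolicy m r) {Ω : Type u} [MeasurableSpace Ω]
          (μ : Measure Ω) [IsProbabilityMeasure μ] (c : ClosedLoop P κ η γ μ),
        ∀ k < κ, c.posteriorCov k = S k)) := by
  refine ⟨fun η γ Ω _ μ _ c => ⟨fun k hk => ⟨c.memLp_free hk.le, ?_⟩,
    c.satisfiesLMI_posteriorCov⟩, fun S _ hS => ⟨fun k hk d => ?_, hS.exists_isSpectralRule,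
    fun η hη γ Ω _ μ _ c k hk => hη.posteriorCov_eq hS c hk⟩⟩
  · rw [secondMoment_eq_covMatrix (c.memLp_free hk.le) (c.integral_free hk.le),
      c.covMatrix_free hk.le]
  · exact ⟨hS.lam_mem_Icc hk d, d.exists_isWeights (hS.lam_mem_Icc hk d)⟩
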